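/- Conventions. All graphs are finite and simple. A \emph{block} is a connected graph without a 1-separator; a \emph{2-separator} of a graph $B$ is a set $\{c,d\}$ of two vertices such that $B-\{c,d\}$ is disconnected. For a subgraph $H$ of $B$, an \emph{$H$-bridge} is either an edge not in $H$ with both endvertices in $H$, or a component $K$ of $B-H$ together with all edges (and their endvertices) joining $K$ to $H$; it is \emph{trivial} if it is just one edge, and its vertices in $H$ are its \emph{attachments}. For a set of vertices $\{c,d\}$, a $\{c,d\}$-bridge is a bridge of the edgeless graph on $\{c,d\}$. Let $B$ be a plane block and let $C$ be the boundary of its outer face (a cycle if $|V(B)|\ge 3$). For $x,y\in V(C)$ let $xCy$ be the clockwise path from $x$ to $y$ in $C$. A bridge is \emph{outer} if it contains an edge of $C$. A \emph{Tutte path} of $B$ is a path $P$ such that every outer $P$-bridge has at most two attachments and every $P$-bridge has at most three attachments. Let $u\in V(C)$, let $v\in V(B)$ with $v\ne u$, and let $\alpha=l_\alpha r_\alpha\in E(C)$, where $r_\alpha$ is the clockwise successor of $l_\alpha$ on $C$. Let $uC\alpha$ and $\alpha Cu$ be the clockwise paths in $C$ from $u$ to $l_\alpha$ and from $r_\alpha$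 to $u$, which do not contain $\alpha$. For a 2-separator $\{c,d\}\subseteq V(C)$, let $B_{cd}^+$ be the $\{c,d\}$-bridge of $B$ that contains $cCd$. \emph{Boundary points.} If $v\in V(C)$, the boundary points of $B$ are $u,l_\alpha,r_\alpha,v$. If $v\notin V(C)$, consider the 2-separators $\{w,w'\}\subseteq V(C)$ of $B$ such that $wCw'$ is contained in one of $uC\alpha$, $\alpha$, $\alpha Cu$ and $v\in B_{ww'}^+$. If there are any, choose one for which $wCw'$ has minimal length; the boundary points are then $u,l_\alpha,r_\alpha$ and all attachments of the $wCw'$-bridge of $B$ that contains $v$. If there are none, the boundary points are $u,l_\alpha,r_\alpha$. \emph{Boundary parts} are the inclusion-wise maximal paths in $C$ that contain no boundary point as an inner vertex. A 2-separator $\{c,d\}$, ordered such that $cCd$ is contained in some boundary part, is \emph{maximal} if for some boundary part $Z\supseteq cCd$ there is no 2-separator $\{c',d'\}$ of $B$ with $cCd\subsetneq c'Cd'\subseteq Z$. Two maximal 2-separators $\{c,d\}$ and $\{c',d'\}$ \emph{interlace} if they are disjoint and their vertices appear in the order $c,c',d,d'$ or $c',c,d',d$ on $C$. \textbf{Lemma.}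 Let $P$ be a Tutte path of $B$ from $u$ to $v$ that contains $\alpha$, and suppose that $P\neq\alpha$, i.e. $P$ does not consist of the single edge $\alpha$. Then (for every choice of $\{w,w'\}$ above, if a choice is made) \begin{enumerate} \item both vertices of every maximal 2-separator of $B$ lie on $P$; \item no two maximal 2-separators of $B$ interlace; \item for every non-trivial outer $P$-bridge $J$ of $B$ there is a maximal 2-separator $\{c,d\}$ of $B$, ordered such that $cCd$ lies in a boundary part in which it is maximal, with $J\subseteq B_{cd}^+$. \end{enumerate} -/

import Mathlib

namespace TuttePaths

variable {V : Type*}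

/-! ### Blocks, separators and bridges -/

/-- A block: a connected graph without a 1-separator. -/
def IsBlock (G : SimpleGraph V) : Prop :=
  G.Connected ∧ ∀ w : V, (G.induce ({w}ᶜ : Set V)).Preconnected

/-- `{c, d}` is a 2-separator of `G`. -/
def IsTwoSeparator (G : SimpleGraph V) (c d : V) : Prop :=
  c ≠ d ∧ ¬ (G.induce ({c, d}ᶜ : Set V)).Preconnected

/-- The subgraph formed by all vertices of `K`, all edges of `G` that have an endvertex in `K`,
and the endvertices of these edges. -/
def closedStar (G : SimpleGraph V) (K : Set V) : G.Subgraph where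
  verts := K ∪ {x | ∃ k ∈ K, G.Adj k x}
  Adj x y := G.Adj x y ∧ (x ∈ K ∨ y ∈ K)
  adj_sub h := h.1
  edge_vert := by
    rintro x y ⟨hxy, hx | hy⟩
    · exact Or.inl hx
    · exact Or.inr ⟨y, hy, hxy.symm⟩
  symm := ⟨fun _ _ h => ⟨h.1.symm, h.2.symm⟩⟩

/-- `J` is an `H`-bridge of `G`: either an edge of `G` that is not in `H` but has both endvertices
in `H`, or a component of `G - H` together with all edges (and their endvertices) that join
it with `H`. -/
def IsBridgeOf {G : SimpleGraph V} (H J : G.Subgraph) : Prop :=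
  (∃ (x y : V) (h : G.Adj x y), x ∈ H.verts ∧ y ∈ H.verts ∧ ¬ H.Adj x y ∧
      J = G.subgraphOfAdj h) ∨
  ∃ K : (G.induce (H.vertsᶜ : Set V)).ConnectedComponent,
    J = closedStar G ((fun x : (H.vertsᶜ : Set V) => (x : V)) '' K.supp)

/-- The attachments of an `H`-bridge `J`. -/
def attachments {G : SimpleGraph V} (H J : G.Subgraph) : Set V := J.verts ∩ H.verts

/-- A bridge is trivial if it is just one edge. -/
def IsTrivialBridge {G : SimpleGraph V} (J : G.Subgraph) : Prop :=
  ∃ (x y : V) (h : G.Adj x y), J = G.subgraphOfAdj h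

/-- The subgraph with vertices `c`, `d` and no edge; its bridges are the `{c, d}`-bridges. -/
def pairSubgraph (G : SimpleGraph V) (c d : V) : G.Subgraph where
  verts := {c, d}
  Adj _ _ := False
  adj_sub h := h.elim
  edge_vert h := h.elim
  symm := ⟨fun _ _ h => h⟩

/-! ### Plane graphs -/

/-- A connected graph embedded in the plane, with a designated outer face, given combinatorially.
`rot` is the clockwise rotation of the darts around their tails. The face boundaries are
the orbits of `d ↦ rot d.symm`, and Euler's formula says that the surface is the sphere.
The outer face is the one whose boundary contains the dart `outer`. -/
structure PlaneEmbedding (G : SimpleGraph V) where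
  connected : G.Connected
  rot : Equiv.Perm G.Dart
  rot_fst : ∀ d, (rot d).fst = d.fst
  rot_sameCycle : ∀ d e : G.Dart, d.fst = e.fst → rot.SameCycle d e
  outer : G.Dart
  euler : Nat.card V +
      Nat.card (Quotient (Equiv.Perm.SameCycle.setoid
        ((Function.Involutive.toPerm _ SimpleGraph.Dart.symm_involutive).trans rot))) =
    Nat.card G.edgeSet + 2

namespace PlaneEmbedding

variable {B : SimpleGraph V} (E : PlaneEmbedding B)

/-- The successor of a dart on the boundary of the face to its left. -/
def faceNext : Equiv.Perm B.Dart :=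
  (Function.Involutive.toPerm _ SimpleGraph.Dart.symm_involutive).trans E.rot

/-- `d` is an edge of the boundary `C` of the outer face, directed clockwise along `C`. -/
def IsOuterDart (d : B.Dart) : Prop := E.faceNext.SameCycle E.outer d

/-- `x` is a vertex of the boundary `C` of the outer face. -/
def OnOuter (x : V) : Prop := ∃ d : B.Dart, E.IsOuterDart d ∧ d.fst = x

/-- `W` is a path that follows `C` in clockwise direction. As `C` is a cycle if `B`
is a block on at least three vertices, the only such path from `x` to `y` is then `xCy`. -/
def IsArc {x y : V} (W : B.Walk x y) : Prop :=
  W.IsPath ∧ ∀ d ∈ W.darts, E.IsOuterDart d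

/-- The subgraph `J` contains an edge of `C`. -/
def IsOuterSubgraph (J : B.Subgraph) : Prop :=
  ∃ d : B.Dart, E.IsOuterDart d ∧ J.Adj d.fst d.snd

/-- Tutte path: a path `P` such that every outer `P`-bridge has at most two
and every `P`-bridge at most three attachments. -/
def IsTuttePath {x y : V} (P : B.Walk x y) : Prop :=
  P.IsPath ∧ ∀ J : B.Subgraph, IsBridgeOf P.toSubgraph J →
    (E.IsOuterSubgraph J → (attachments P.toSubgraph J).encard ≤ 2) ∧
      (attachments P.toSubgraph J).encard ≤ 3

/-- `J` is the subgraph `B_{cd}^+`: the `{c, d}`-bridge of `B` that contains the path `cCd`. -/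
def IsPlusBridge (c d : V) (J : B.Subgraph) : Prop :=
  IsBridgeOf (pairSubgraph B c d) J ∧
    ∃ W : B.Walk c d, E.IsArc W ∧ W.toSubgraph ≤ J

/-! ### Boundary points and boundary parts

Here `u`, `v` are the prescribed end vertices and `a` is the prescribed edge `α` of `C`, directed
clockwise, so that its first and second vertex are `l_α` and `r_α`. -/

/-- `H` is contained in one of the three paths `uCα`, `α`, `αCu`. -/
def InThreeParts (u : V) (a : B.Dart) (H : B.Subgraph) : Prop :=
  (∃ X : B.Walk u a.fst, E.IsArc X ∧ a.edge ∉ X.edges ∧ H ≤ X.toSubgraph) ∨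
  H ≤ B.subgraphOfAdj a.adj ∨
  (∃ Y : B.Walk a.snd u, E.IsArc Y ∧ a.edge ∉ Y.edges ∧ H ≤ Y.toSubgraph)

/-- `W` is a path `w₁Cw_p` in one of `uCα`, `α`, `αCu`, where `{w₁, w_p}` is a
2-separator such that `B_{w₁w_p}^+` contains `v`. -/
def Encloses (u : V) (a : B.Dart) (v : V) {w₁ wp : V} (W : B.Walk w₁ wp) : Prop :=
  IsTwoSeparator B w₁ wp ∧ E.IsArc W ∧ E.InThreeParts u a W.toSubgraph ∧
    ∃ J : B.Subgraph, E.IsPlusBridge w₁ wp J ∧ v ∈ J.verts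

/-- `W` has minimal length among the paths `w₁Cw_p` as above. -/
def EnclosesMinimally (u : V) (a : B.Dart) (v : V) {w₁ wp : V} (W : B.Walk w₁ wp) : Prop :=
  E.Encloses u a v W ∧
    ∀ (x y : V) (X : B.Walk x y), E.Encloses u a v X → W.length ≤ X.length

/-- `S` is the set of boundary points of `B`: the vertices `u`, `l_α`, `r_α`, together with `v` if
`v` is on `C`, and otherwise together with the attachments of the `w₁Cw_p`-bridge that
contains `v`, if a 2-separator `{w₁, w_p}` as above exists. -/
def IsBoundaryPoints (u : V) (a : B.Dart) (v : V) (S : Set V) : Prop :=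
  (E.OnOuter v ∧ S = {u, a.fst, a.snd, v}) ∨
  (¬ E.OnOuter v ∧
    ((∃ (w₁ wp : V) (W : B.Walk w₁ wp) (J : B.Subgraph), E.EnclosesMinimally u a v W ∧
        IsBridgeOf W.toSubgraph J ∧ v ∈ J.verts ∧
        S = {u, a.fst, a.snd} ∪ attachments W.toSubgraph J) ∨
     ((¬ ∃ (w₁ wp : V) (W : B.Walk w₁ wp), E.Encloses u a v W) ∧
        S = {u, a.fst, a.snd})))

/-- `Z` is a path of `C` without an inner vertex in `S`. -/
def IsFreeArc (S : Set V) {p q : V} (Z : B.Walk p q) : Prop :=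
  E.IsArc Z ∧ ∀ x ∈ Z.support, x ≠ p → x ≠ q → x ∉ S

/-- `Z` is a boundary part: an inclusion-wise maximal path of `C` that does not contain
a boundary point as inner vertex. -/
def IsBoundaryPart (S : Set V) {p q : V} (Z : B.Walk p q) : Prop :=
  E.IsFreeArc S Z ∧ ∀ (p' q' : V) (Z' : B.Walk p' q'), E.IsFreeArc S Z' →
    Z.toSubgraph ≤ Z'.toSubgraph → Z'.toSubgraph ≤ Z.toSubgraph

/-- `{c, d}` is a 2-separator of `B` and `W` is the path `cCd`, contained in `Z`. -/
def IsSeparatorIn {p q : V} (Z : B.Walk p q) {c d : V} (W : B.Walk c d) : Prop :=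
  IsTwoSeparator B c d ∧ E.IsArc W ∧ W.toSubgraph ≤ Z.toSubgraph

/-- `{c, d}^*` is a maximal 2-separator: for some boundary part `Z`, it is a 2-separator
with `cCd ⊆ Z`, and there is no 2-separator `{c', d'}` with `cCd ⊂ c'Cd' ⊆ Z`. -/
def IsMaximalSeparator (S : Set V) (c d : V) : Prop :=
  ∃ (p q : V) (Z : B.Walk p q) (W : B.Walk c d),
    E.IsBoundaryPart S Z ∧ E.IsSeparatorIn Z W ∧
    ∀ (c' d' : V) (W' : B.Walk c' d'), E.IsSeparatorIn Z W' →
      ¬ W.toSubgraph < W'.toSubgraph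

/-- The vertices `x`, `y`, `z`, `t` appear in this clockwise order on `C`. -/
def InClockwiseOrder (x y z t : V) : Prop :=
  ∃ (W₁ : B.Walk x y) (W₂ : B.Walk y z) (W₃ : B.Walk z t),
    E.IsArc ((W₁.append W₂).append W₃)

/-- `{c, d}^*` and `{c', d'}^*` interlace. -/
def Interlace (c d c' d' : V) : Prop :=
  Disjoint ({c, d} : Set V) {c', d'} ∧
    (E.InClockwiseOrder c c' d d' ∨ E.InClockwiseOrder c' c d' d)

end PlaneEmbedding

end TuttePaths

namespace TuttePaths

open SimpleGraph

/-! ### Darts under reversal and rotation. -/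

namespace PlaneEmbedding

variable {V : Type*} {B : SimpleGraph V} (E : PlaneEmbedding B)

/-! Topology enters only through homology modulo 2. By Euler's formula every cycle modulo 2 is a sum
of face boundaries (`range_faceBoundary`), so each closed walk divides the faces into two sides
(`exists_side`). Two consequences are used: the outer boundary of a block repeats no vertex
(`IsOuterDart.eq_of_fst_eq`), and disjoint connected sets cannot join interlacing pairs of outer
vertices (`not_crossing`). Cutting `C` at `α` numbers its vertices from `r_α` (index 0) to `l_α`
(index `lastIndex`), and arcs that avoid `α` become intervals of indices.

The heart is the uncrossing lemma `IsBoundaryPoints.isTwoSeparator_of_crossing`. Let `{p, q}` and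
`{p', q'}` be 2-separators with `p < p' < q < q'` and no boundary point strictly between `p` and
`q'`. The parts that they cut off have a union whose only outside neighbours are `p` and `q'`, so
`{p, q'}` is a 2-separator unless this union is all the rest of `B`. In that exceptional case `p`
and `q'` are the ends of `α`, `u` is one of them, and `v` is in the union but not on `C`. Now the
boundary points that come from the bridge around `v` are needed: as none is strictly between `p` and
`q'`, this bridge is attached only at these two vertices, which therefore separate after all.

A component of `B - P` that meets `C` has at most two attachments. It meets `C` in the interior of
one interval, whose ends form a 2-separator because `P` has a third vertex, and which has no
boundary point inside (`IsTuttePath.exists_interval`). Enlarging this separator to a maximal one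
gives the third assertion. A vertex of a maximal separator off `P` would be an inner vertex of such
an interval, which then contains the separator properly or crosses it; by uncrossing, both
contradict maximality. Likewise, interlacing maximal separators would uncross to a larger one. -/

theorem faceNext_apply (d : B.Dart) : E.faceNext d = E.rot d.symm := rfl

theorem faceNext_fst (d : B.Dart) : (E.faceNext d).fst = d.snd := by
  rw [faceNext_apply, E.rot_fst]; rfl

/-- A property of darts that is preserved by reversal and rotation holds for all darts
if it holds for one. -/
theorem dart_induction {p : B.Dart → Prop} (hs : ∀ d, p d → p d.symm)
    (hr : ∀ d, p d → p (E.rot d)) [Finite B.Dart] {d₀ : B.Dart} (h₀ : p d₀) (d : B.Dart) : p d := by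
  have rotAll : ∀ d e : B.Dart, d.fst = e.fst → p d → p e := by
    intro d e hde hd
    obtain ⟨k, hk⟩ := (E.rot_sameCycle d e hde).exists_nat_pow_eq
    rw [← hk]
    clear hk
    induction k with
    | zero => simpa using hd
    | succ k ih => rw [pow_succ', Equiv.Perm.mul_apply]; exact hr _ ih
  obtain ⟨w⟩ := E.connected.preconnected d₀.fst d.fst
  suffices ∀ x y (w : B.Walk x y), (∀ d, d.fst = x → p d) → ∀ d, d.fst = y → p d from
    this _ _ w (fun e he => rotAll d₀ e he.symm h₀) d rfl
  intro x y w
  induction w with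
  | nil => exact fun h => h
  | cons h w ih =>
    intro hx
    refine ih fun d hd => ?_
    exact rotAll _ d hd.symm (hs _ (hx ⟨(_, _), h⟩ rfl))

end PlaneEmbedding

/-! ### Chains of edges modulo 2. -/

section Boundary

open scoped Classical in
/-- The boundary of a set of edges, modulo two. -/
noncomputable def edgeBoundary {V : Type*} (B : SimpleGraph V) [Fintype B.Dart] :
    (B.edgeSet → ZMod 2) →ₗ[ZMod 2] (V → ZMod 2) where
  toFun D x := ∑ d : B.Dart, if d.fst = x then D ⟨d.edge, d.edge_mem⟩ else 0
  map_add' D D' := by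
    funext x
    simp only [Pi.add_apply, ← Finset.sum_add_distrib]
    exact Finset.sum_congr rfl fun d _ => by split_ifs <;> simp
  map_smul' r D := by
    funext x
    simp only [Pi.smul_apply, Finset.smul_sum, RingHom.id_apply]
    exact Finset.sum_congr rfl fun d _ => by split_ifs <;> simp

open scoped Classical in
/-- The characteristic function of the edges that a walk traverses an odd number of times. -/
noncomputable def walkParity {V : Type*} {B : SimpleGraph V} {x y : V} (w : B.Walk x y) :
    B.edgeSet → ZMod 2 := fun e => (w.edges.count e.1 : ZMod 2)

open scoped Classical in
-- Prepending an edge `xz` adds `x + z`, and the two copies of `z` cancel. In particular, closed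
-- walks have boundary zero.
theorem edgeBoundary_walkParity {V : Type*} {B : SimpleGraph V} [Fintype B.Dart] {x y : V}
    (w : B.Walk x y) :
    edgeBoundary B (walkParity w) = Pi.single x 1 + Pi.single y 1 := by
  induction w with
  | nil =>
    rename_i u
    have : walkParity (Walk.nil : B.Walk u u) = 0 := by
      funext e; simp [walkParity]
    rw [this, map_zero]
    funext z
    by_cases h : z = u <;> simp [h, CharTwo.add_self_eq_zero]
  | @cons x z y h w ih =>
    have hw : walkParity (Walk.cons h w) =
        Pi.single ⟨s(x, z), h⟩ 1 + walkParity w := by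
      funext e
      simp only [walkParity, Walk.edges_cons, List.count_cons, Pi.add_apply]
      by_cases he : e = ⟨s(x, z), h⟩
      · subst he; simp [add_comm]
      · have : ¬ (s(x, z) = e.1) := fun h' => he (Subtype.ext h'.symm)
        simp [this, he]
    rw [hw, map_add, ih]
    have h1 : edgeBoundary B (Pi.single ⟨s(x, z), h⟩ 1) = Pi.single x 1 + Pi.single z 1 := by
      funext t
      change (∑ d : B.Dart, if d.fst = t then
        (Pi.single ⟨s(x, z), h⟩ 1 : B.edgeSet → ZMod 2) ⟨d.edge, d.edge_mem⟩ else 0) = _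
      have hne : (⟨(x, z), h⟩ : B.Dart) ≠ ⟨(z, x), h.symm⟩ := by
        intro h'
        exact h.ne (congrArg (fun d : B.Dart => d.fst) h')
      -- Only the two darts of the edge contribute to the sum.
      rw [← Finset.sum_subset (Finset.subset_univ {(⟨(x, z), h⟩ : B.Dart), ⟨(z, x), h.symm⟩})]
      · rw [Finset.sum_pair hne]
        have e2 : (⟨s(z, x), h.symm⟩ : B.edgeSet) = ⟨s(x, z), h⟩ := Subtype.ext Sym2.eq_swap
        simp [Dart.edge, e2, Pi.single_apply, eq_comm]
      · intro d _ hd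
        have : (⟨d.edge, d.edge_mem⟩ : B.edgeSet) ≠ ⟨s(x, z), h⟩ := by
          intro h'
          have h2 : d.edge = (⟨(x, z), h⟩ : B.Dart).edge := congrArg Subtype.val h'
          rw [dart_edge_eq_iff] at h2
          apply hd
          rcases h2 with h2 | h2 <;> simp [h2, Dart.symm]
        simp [this]
    rw [h1]
    funext t
    simp only [Pi.add_apply]
    have := CharTwo.add_self_eq_zero ((Pi.single z 1 : V → ZMod 2) t)
    linear_combination this

end Boundary

/-! ### Euler's formula as the vanishing of the first homology modulo 2. -/

namespace PlaneEmbedding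

variable {V : Type*} {B : SimpleGraph V} (E : PlaneEmbedding B)

/-- The faces of a plane graph. -/
abbrev Face := Quotient (Equiv.Perm.SameCycle.setoid E.faceNext)

/-- The face to the left of a dart. -/
def face (d : B.Dart) : E.Face := Quotient.mk _ d

theorem face_faceNext (d : B.Dart) : E.face (E.faceNext d) = E.face d :=
  Quotient.sound (Equiv.Perm.sameCycle_apply_left.2 (Equiv.Perm.SameCycle.refl _ _))

theorem face_rot (d : B.Dart) : E.face (E.rot d) = E.face d.symm := by
  rw [← E.face_faceNext d.symm, faceNext_apply, Dart.symm_symm]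

theorem exists_dart_edge_eq (e : B.edgeSet) : ∃ d : B.Dart, d.edge = e := by
  obtain ⟨e, he⟩ := e
  induction e with
  | h x y => exact ⟨⟨(x, y), he⟩, rfl⟩

/-- The sum of the boundaries of a set of faces, modulo two. -/
noncomputable def faceBoundary : (E.Face → ZMod 2) →ₗ[ZMod 2] (B.edgeSet → ZMod 2) where
  toFun g e := g (E.face (exists_dart_edge_eq e).choose) +
    g (E.face (exists_dart_edge_eq e).choose.symm)
  map_add' g g' := by funext e; simp only [Pi.add_apply]; ring
  map_smul' r g := by funext e; simp only [Pi.smul_apply, smul_eq_mul, RingHom.id_apply]; ring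

/-- The sum is symmetric under reversal, so the dart chosen for the edge does not matter. -/
theorem faceBoundary_edge (g : E.Face → ZMod 2) (d : B.Dart) :
    E.faceBoundary g ⟨d.edge, d.edge_mem⟩ = g (E.face d) + g (E.face d.symm) := by
  have h := (exists_dart_edge_eq (⟨d.edge, d.edge_mem⟩ : B.edgeSet)).choose_spec
  change g (E.face (exists_dart_edge_eq _).choose) +
    g (E.face (exists_dart_edge_eq _).choose.symm) = _
  rcases (dart_edge_eq_iff _ _).1 h with h | h
  · rw [h]
  · rw [h, Dart.symm_symm, add_comm]

/-- Each dart at `x` contributes the values of the faces on its two sides. By `face_rot`, the second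
value at `d` is the first value at `rot d`, so around `x` every value occurs twice. -/
theorem edgeBoundary_faceBoundary [Fintype B.Dart] (g : E.Face → ZMod 2) :
    edgeBoundary B (E.faceBoundary g) = 0 := by
  classical
  funext x
  change (∑ d : B.Dart, if d.fst = x then
    E.faceBoundary g ⟨d.edge, d.edge_mem⟩ else 0) = 0
  have h1 : ∀ d : B.Dart, (if d.fst = x then E.faceBoundary g ⟨d.edge, d.edge_mem⟩ else 0) =
      (if d.fst = x then g (E.face d) else 0) +
        (fun e : B.Dart => if e.fst = x then g (E.face e) else 0) (E.rot d) := by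
    intro d
    simp only [faceBoundary_edge, E.rot_fst, E.face_rot]
    split_ifs <;> simp
  rw [Finset.sum_congr rfl fun d _ => h1 d, Finset.sum_add_distrib,
    Equiv.sum_comp E.rot (fun e : B.Dart => if e.fst = x then g (E.face e) else 0)]
  exact CharTwo.add_self_eq_zero _

/-- A dimension count. With `V`, `E`, `F` the numbers of vertices, edges and faces, the range has
dimension at least `F - 1` and the kernel at most `E - (V - 1)`; these are equal by Euler's formula.
-/
theorem range_faceBoundary [Finite V] [Fintype B.Dart] :
    LinearMap.range E.faceBoundary = LinearMap.ker (edgeBoundary B) := by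
  classical
  have : Fintype V := Fintype.ofFinite V
  have : Fintype B.edgeSet := Fintype.ofFinite _
  have : Finite E.Face := Quotient.finite _
  have : Fintype E.Face := Fintype.ofFinite _
  have hle : LinearMap.range E.faceBoundary ≤ LinearMap.ker (edgeBoundary B) := by
    rintro _ ⟨g, rfl⟩
    exact E.edgeBoundary_faceBoundary g
  refine Submodule.eq_of_le_of_finrank_le hle ?_
  have heuler : Fintype.card V + Fintype.card E.Face = Fintype.card B.edgeSet + 2 := by
    have := E.euler
    simp only [← Nat.card_eq_fintype_card]
    exact this
  have hV := (edgeBoundary B).finrank_range_add_finrank_ker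
  have hF := (E.faceBoundary).finrank_range_add_finrank_ker
  rw [Module.finrank_fintype_fun_eq_card] at hV hF
  -- A function with zero boundary agrees on the two sides of every edge, so by connectedness it is
  -- constant.
  have hker : Module.finrank (ZMod 2) (LinearMap.ker E.faceBoundary) ≤ 1 := by
    have : LinearMap.ker E.faceBoundary ≤
        Submodule.span (ZMod 2) {(fun _ => 1 : E.Face → ZMod 2)} := by
      intro g hg
      rw [LinearMap.mem_ker] at hg
      rw [Submodule.mem_span_singleton]
      refine ⟨g (E.face E.outer), funext fun q => ?_⟩
      have hd : ∀ d : B.Dart, g (E.face d) = g (E.face d.symm) := by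
        intro d
        have := E.faceBoundary_edge g d
        rw [hg] at this
        exact (CharTwo.add_eq_zero.1 this.symm)
      induction q using Quotient.inductionOn with
      | h d =>
        change _ = g (E.face d)
        have := E.dart_induction (p := fun d => g (E.face d) = g (E.face E.outer))
          (fun d h => by rw [← hd d, h]) (fun d h => by rw [E.face_rot, ← hd d, h]) rfl d
        simp [this]
    exact (Submodule.finrank_mono this).trans ((finrank_span_le_card _).trans (by simp))
  -- Each vertex differs from a fixed `x₀` by the boundary of a walk, so the edge boundary has
  -- corank at most one.
  have hrange : Fintype.card V ≤ Module.finrank (ZMod 2) (LinearMap.range (edgeBoundary B)) + 1 := by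
    let x₀ := E.outer.fst
    have htop : (⊤ : Submodule (ZMod 2) (V → ZMod 2)) ≤ LinearMap.range (edgeBoundary B) ⊔
        Submodule.span (ZMod 2) {(Pi.single x₀ 1 : V → ZMod 2)} := by
      intro f _
      rw [pi_eq_sum_univ' f]
      refine Submodule.sum_mem _ fun x _ => Submodule.smul_mem _ _ ?_
      obtain ⟨w⟩ := E.connected.preconnected x x₀
      have h1 : (Pi.single x 1 : V → ZMod 2) =
          edgeBoundary B (walkParity w) + Pi.single x₀ 1 := by
        rw [edgeBoundary_walkParity]
        funext t
        have := CharTwo.add_self_eq_zero ((Pi.single x₀ 1 : V → ZMod 2) t)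
        simp only [Pi.add_apply]
        rw [add_assoc, this, add_zero]
      rw [h1]
      exact Submodule.add_mem_sup ⟨_, rfl⟩ (Submodule.mem_span_singleton_self _)
    have h2 := Submodule.finrank_mono htop
    rw [finrank_top, Module.finrank_fintype_fun_eq_card] at h2
    refine h2.trans ((Submodule.finrank_add_le_finrank_add_finrank _ _).trans ?_)
    exact Nat.add_le_add_left ((finrank_span_le_card _).trans (by simp)) _
  omega

/-- On the sphere, every closed walk separates the faces into two classes. -/
theorem exists_side [Finite V] {x : V} (w : B.Walk x x) [DecidableEq V] :
    ∃ s : B.Dart → ZMod 2, (∀ d, s (E.faceNext d) = s d) ∧ (∀ d, s (E.rot d) = s d.symm) ∧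
      ∀ d : B.Dart, s d + s d.symm = (w.edges.count d.edge : ZMod 2) := by
  classical
  have : Finite B.Dart := Finite.of_injective _ (Dart.toProd_injective)
  have : Fintype B.Dart := Fintype.ofFinite _
  have hw : walkParity w ∈ LinearMap.ker (edgeBoundary B) := by
    rw [LinearMap.mem_ker, edgeBoundary_walkParity]
    exact funext fun t => CharTwo.add_self_eq_zero _
  rw [← E.range_faceBoundary] at hw
  obtain ⟨g, hg⟩ := hw
  refine ⟨fun d => g (E.face d), fun d => by simp only [E.face_faceNext],
    fun d => by simp only [E.face_rot], fun d => ?_⟩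
  rw [← E.faceBoundary_edge, hg, walkParity]
  congr!

end PlaneEmbedding

/-- Two vertices of a preconnected induced subgraph are joined by a path inside it. -/
theorem exists_path_of_preconnected {V : Type*} {B : SimpleGraph V} {X : Set V}
    (hX : (B.induce X).Preconnected) {x y : V} (hx : x ∈ X) (hy : y ∈ X) :
    ∃ w : B.Walk x y, w.IsPath ∧ ∀ z ∈ w.support, z ∈ X := by
  classical
  obtain ⟨w⟩ := hX ⟨x, hx⟩ ⟨y, hy⟩
  refine ⟨(w.map (Embedding.induce X).toHom).bypass, Walk.bypass_isPath _, fun z hz => ?_⟩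
  have := Walk.support_bypass_subset_support _ hz
  erw [Walk.support_map] at this
  obtain ⟨z', _, rfl⟩ := List.mem_map.1 this
  exact z'.2

/-! ### The outer boundary of a block is a cycle. -/

namespace PlaneEmbedding

variable {V : Type*} {B : SimpleGraph V} (E : PlaneEmbedding B)

/-- A side is constant along a face boundary, which gives the outer face one value to compare others
with. -/
theorem side_eq_of_isOuterDart {s : B.Dart → ZMod 2} (hs : ∀ d, s (E.faceNext d) = s d)
    {d e : B.Dart} (hd : E.IsOuterDart d) (he : E.IsOuterDart e) : s d = s e := by
  obtain ⟨k, hk⟩ := (hd.symm.trans he)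
  rw [← hk]
  clear hk
  induction k using Int.induction_on with
  | zero => simp
  | succ k ih => rw [ih, add_comm, zpow_add, Equiv.Perm.mul_apply, zpow_one, hs]
  | pred k ih =>
    rw [ih, ← hs ((E.faceNext ^ (-(k : ℤ) - 1)) d), ← Equiv.Perm.mul_apply, ← zpow_one_add]
    congr 3; ring

/-- Rotating from a dart `d` to `e`, the side changes exactly at the edges of the closed walk. -/
theorem side_pow_rot {s t : B.Dart → ZMod 2} (hr : ∀ d, s (E.rot d) = s d.symm)
    (ht : ∀ d, s d + s d.symm = t d) {d : B.Dart} (k : ℕ)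
    (hk : ∀ i < k, t ((E.rot ^ i) d) = 0) : s ((E.rot ^ k) d) = s d := by
  induction k with
  | zero => simp
  | succ k ih =>
    rw [pow_succ', Equiv.Perm.mul_apply, hr, ← ih fun i hi => hk i (by omega)]
    have := ht ((E.rot ^ k) d)
    rw [hk k (by omega)] at this
    exact (CharTwo.add_eq_zero.1 this).symm

theorem pow_rot_fst (k : ℕ) (d : B.Dart) : ((E.rot ^ k) d).fst = d.fst := by
  induction k with
  | zero => simp
  | succ k ih => rw [pow_succ', Equiv.Perm.mul_apply, E.rot_fst, ih]

/-- The boundary of the outer face of a block visits every vertex at most once. -/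
theorem IsOuterDart.eq_of_fst_eq [Finite V] (hB : IsBlock B) {d e : B.Dart}
    (hd : E.IsOuterDart d) (he : E.IsOuterDart e) (hde : d.fst = e.fst) : d = e := by
  classical
  by_contra hne
  have : Finite B.Dart := Finite.of_injective _ (Dart.toProd_injective)
  have hsnd : d.snd ≠ e.snd := fun h => hne (Dart.ext _ _ (Prod.ext hde h))
  obtain ⟨w, hwp, hw⟩ := exists_path_of_preconnected (hB.2 d.fst)
    (x := d.snd) (y := e.snd) d.snd_ne_fst (by rw [hde]; exact e.snd_ne_fst)
  -- As the path avoids the common tail of `d` and `e`, the closed walk uses exactly these two edges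
  -- at that vertex.
  let w' : B.Walk d.fst d.fst :=
    Walk.cons d.adj (w.concat (by rw [hde]; exact e.adj.symm : B.Adj e.snd d.fst))
  obtain ⟨s, hf, hr, hc⟩ := E.exists_side w'
  have hnot : ∀ f : B.Dart, f.fst = d.fst → f.edge ∉ w.edges := by
    intro f hf h
    exact hw _ (w.fst_mem_support_of_mem_edges (hf ▸ h : s(d.fst, f.snd) ∈ w.edges)) rfl
  have hcount : ∀ f : B.Dart, f.fst = d.fst →
      (w'.edges.count f.edge : ZMod 2) = (if f = d then 1 else 0) + (if f = e then 1 else 0) := by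
    intro f hfd
    have h1 : ∀ g : B.Dart, g.fst = d.fst → (s(g.fst, g.snd) = f.edge ↔ f = g) := by
      intro g hg
      have := dart_edge_eq_iff g f
      rw [show s(g.fst, g.snd) = g.edge from rfl, this]
      constructor
      · rintro (h | h)
        · exact h.symm
        · exact absurd (hfd.trans (hg.symm.trans (h ▸ rfl)) : f.fst = f.snd) f.fst_ne_snd
      · exact fun h => Or.inl h.symm
    have h2 : s(e.snd, d.fst) = s(e.fst, e.snd) := by rw [hde, Sym2.eq_swap]
    simp only [w', Walk.edges_cons, Walk.edges_concat, List.concat_eq_append, List.count_cons,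
      List.count_append, List.count_nil, List.count_eq_zero_of_not_mem (hnot f hfd), beq_iff_eq,
      h2, h1 d rfl, h1 e hde.symm]
    split_ifs <;> norm_num
  obtain ⟨k, hk⟩ := (E.rot_sameCycle d e hde).exists_nat_pow_eq
  have hex : ∃ k, (E.rot ^ k) d = e := ⟨k, hk⟩
  have hmin := fun i (hi : i < Nat.find hex) => Nat.find_min hex hi
  have hspec := Nat.find_spec hex
  set n := Nat.find hex
  obtain ⟨n', hn'⟩ : ∃ n', n = n' + 1 := by
    refine Nat.exists_eq_succ_of_ne_zero fun h0 => hne ?_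
    rw [h0] at hspec; simpa using hspec
  -- Strictly between `d` and the first return to `e` the rotation meets no edge of the walk. Hence
  -- `e` has the side of `rot d`, which is that of `d.symm` and differs from that of `d`, although
  -- `d` and `e` are both outer.
  have h1 : s ((E.rot ^ n') (E.rot d)) = s (E.rot d) := by
    refine E.side_pow_rot hr hc n' fun i hi => ?_
    rw [← Equiv.Perm.mul_apply, ← pow_succ]
    rw [hcount _ (E.pow_rot_fst _ _), if_neg, if_neg (hmin _ (by omega)), add_zero]
    intro h
    -- Coming back to `d` before `e` would allow a shorter rotation from `d` to `e`.
    refine hmin (n - (i + 1)) (by omega) ?_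
    rw [← hspec]
    conv_rhs => rw [show n = (n - (i + 1)) + (i + 1) by omega, pow_add, Equiv.Perm.mul_apply, h]
  rw [← Equiv.Perm.mul_apply, ← pow_succ, ← hn', hspec, hr] at h1
  have h2 := hc d
  rw [← h1, hcount d rfl, if_pos rfl, if_neg hne, E.side_eq_of_isOuterDart hf hd he,
    CharTwo.add_self_eq_zero] at h2
  exact absurd h2 (by decide)

/-! ### The cyclic sequence of the outer vertices -/

section Cycle

variable (a : B.Dart)

/-- The outer darts in clockwise order, starting with the one after `a`. -/
def outDart (t : ℕ) : B.Dart := E.faceNext^[t + 1] a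

/-- The outer vertices in clockwise order, starting with the head of `a`. -/
def outVert (t : ℕ) : V := (E.outDart a t).fst

theorem outDart_succ (t : ℕ) : E.outDart a (t + 1) = E.faceNext (E.outDart a t) :=
  Function.iterate_succ_apply' _ _ _

theorem outDart_snd (t : ℕ) : (E.outDart a t).snd = E.outVert a (t + 1) := by
  rw [outVert, outDart_succ, E.faceNext_fst]

theorem outVert_zero : E.outVert a 0 = a.snd := E.faceNext_fst a

theorem adj_outVert (t : ℕ) : B.Adj (E.outVert a t) (E.outVert a (t + 1)) := by
  rw [← outDart_snd]; exact (E.outDart a t).adj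

/-- The index of the last outer vertex, which is the tail of `a`. -/
noncomputable def lastIndex : ℕ := Function.minimalPeriod E.faceNext a - 1

theorem lastIndex_add_one [Finite V] :
    E.lastIndex a + 1 = Function.minimalPeriod E.faceNext a := by
  have : Finite B.Dart := Finite.of_injective _ (Dart.toProd_injective)
  have : 0 < Function.minimalPeriod E.faceNext a :=
    Function.minimalPeriod_pos_of_mem_periodicPts
      (Function.Injective.mem_periodicPts E.faceNext.injective a)
  rw [lastIndex]; omega

theorem outDart_lastIndex [Finite V] : E.outDart a (E.lastIndex a) = a := by
  rw [outDart, lastIndex_add_one, Function.iterate_minimalPeriod]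

theorem outVert_lastIndex [Finite V] : E.outVert a (E.lastIndex a) = a.fst := by
  rw [outVert, outDart_lastIndex]

theorem outDart_add_period [Finite V] (t : ℕ) :
    E.outDart a (t + (E.lastIndex a + 1)) = E.outDart a t := by
  rw [outDart, lastIndex_add_one, Nat.add_right_comm, Function.iterate_add_minimalPeriod_eq]
  rfl

theorem outVert_add_period [Finite V] (t : ℕ) :
    E.outVert a (t + (E.lastIndex a + 1)) = E.outVert a t := by
  rw [outVert, outDart_add_period, outVert]

variable {a}

theorem isOuterDart_outDart (ha : E.IsOuterDart a) (t : ℕ) : E.IsOuterDart (E.outDart a t) := by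
  refine ha.trans ⟨((t + 1 : ℕ) : ℤ), ?_⟩
  rw [zpow_natCast, outDart, Equiv.Perm.iterate_eq_pow]

theorem exists_outDart_eq [Finite V] (ha : E.IsOuterDart a) {d : B.Dart} (hd : E.IsOuterDart d) :
    ∃ t ≤ E.lastIndex a, E.outDart a t = d := by
  have : Finite B.Dart := Finite.of_injective _ (Dart.toProd_injective)
  obtain ⟨k, hk⟩ := (ha.symm.trans hd).exists_nat_pow_eq
  have h := E.lastIndex_add_one a
  refine ⟨(k + E.lastIndex a) % (E.lastIndex a + 1),
    Nat.lt_succ_iff.1 (Nat.mod_lt _ (Nat.succ_pos _)), ?_⟩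
  have h2 : E.outDart a (k + E.lastIndex a) = d := by
    rw [outDart, Nat.add_assoc, h, Function.iterate_add_minimalPeriod_eq, ← hk,
      Equiv.Perm.iterate_eq_pow]
  rw [← h2]
  generalize k + E.lastIndex a = r
  rw [outDart, outDart, Function.iterate_succ_apply', Function.iterate_succ_apply', h,
    Function.iterate_mod_minimalPeriod_eq]

theorem outDart_inj [Finite V] {s t : ℕ} (hs : s ≤ E.lastIndex a)
    (ht : t ≤ E.lastIndex a) (h : E.outDart a s = E.outDart a t) : s = t := by
  have hm := E.lastIndex_add_one a
  rw [outDart, outDart, Function.iterate_succ_apply', Function.iterate_succ_apply'] at h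
  exact (Function.iterate_eq_iterate_iff_of_lt_minimalPeriod (by omega) (by omega)).1
    (E.faceNext.injective h)

theorem outVert_inj [Finite V] (hB : IsBlock B) (ha : E.IsOuterDart a) {s t : ℕ}
    (hs : s ≤ E.lastIndex a) (ht : t ≤ E.lastIndex a) (h : E.outVert a s = E.outVert a t) :
    s = t :=
  E.outDart_inj hs ht (IsOuterDart.eq_of_fst_eq E hB (E.isOuterDart_outDart ha s)
    (E.isOuterDart_outDart ha t) h)

theorem onOuter_iff [Finite V] (ha : E.IsOuterDart a) {x : V} :
    E.OnOuter x ↔ ∃ t ≤ E.lastIndex a, x = E.outVert a t := by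
  constructor
  · rintro ⟨d, hd, rfl⟩
    obtain ⟨t, ht, rfl⟩ := E.exists_outDart_eq ha hd
    exact ⟨t, ht, rfl⟩
  · rintro ⟨t, _, rfl⟩
    exact ⟨_, E.isOuterDart_outDart ha t, rfl⟩

/-- `W` runs through the outer darts with the indices `i`, ..., `i + L - 1`. -/
def RunsFrom (a : B.Dart) (i L : ℕ) {x y : V} (W : B.Walk x y) : Prop :=
  W.darts = (List.range L).map fun t => E.outDart a (i + t)

theorem exists_runsFrom (i L : ℕ) :
    ∃ W : B.Walk (E.outVert a i) (E.outVert a (i + L)), E.RunsFrom a i L W := by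
  induction L with
  | zero => exact ⟨Walk.nil, by simp [RunsFrom]⟩
  | succ L ih =>
    obtain ⟨W, hW⟩ := ih
    refine ⟨W.concat (E.adj_outVert a (i + L)), ?_⟩
    rw [RunsFrom] at hW ⊢
    rw [Walk.darts_concat, hW, List.range_succ, List.map_append, List.concat_eq_append]
    congr 1
    simp only [List.map_cons, List.map_nil, List.cons.injEq, and_true]
    exact Dart.ext _ _ (Prod.ext rfl (E.outDart_snd a _).symm)

namespace RunsFrom

variable {E} {i L : ℕ} {x y : V} {W : B.Walk x y}

theorem length_eq (hW : E.RunsFrom a i L W) : W.length = L := by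
  rw [← Walk.length_darts, hW]; simp

theorem mem_darts (hW : E.RunsFrom a i L W) {d : B.Dart} :
    d ∈ W.darts ↔ ∃ t < L, d = E.outDart a (i + t) := by
  rw [hW, List.mem_map]
  simp only [List.mem_range, eq_comm]

theorem support_eq (hW : E.RunsFrom a i L W) (hx : x = E.outVert a i) :
    W.support = (List.range (L + 1)).map fun t => E.outVert a (i + t) := by
  rw [← Walk.cons_map_snd_darts, hW, List.range_succ_eq_map, List.map_cons, List.map_map,
    List.map_map, hx]
  congr 1
  refine List.map_congr_left fun t _ => ?_
  exact E.outDart_snd a (i + t)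

theorem mem_support (hW : E.RunsFrom a i L W) (hx : x = E.outVert a i) {z : V} :
    z ∈ W.support ↔ ∃ t ≤ L, z = E.outVert a (i + t) := by
  rw [hW.support_eq hx, List.mem_map]
  simp only [List.mem_range, eq_comm, Nat.lt_succ_iff]

theorem isPath [Finite V] (hB : IsBlock B) (ha : E.IsOuterDart a) (hW : E.RunsFrom a i L W)
    (hx : x = E.outVert a i) (hL : i + L ≤ E.lastIndex a) : W.IsPath := by
  rw [Walk.isPath_def, hW.support_eq hx]
  refine List.Nodup.map_on (fun s hs t ht h => ?_) List.nodup_range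
  rw [List.mem_range] at hs ht
  have := E.outVert_inj hB ha (by omega) (by omega) h
  omega

theorem isArc [Finite V] (hB : IsBlock B) (ha : E.IsOuterDart a) (hW : E.RunsFrom a i L W)
    (hx : x = E.outVert a i) (hL : i + L ≤ E.lastIndex a) : E.IsArc W := by
  refine ⟨hW.isPath hB ha hx hL, fun d hd => ?_⟩
  obtain ⟨t, _, rfl⟩ := hW.mem_darts.1 hd
  exact E.isOuterDart_outDart ha _

end RunsFrom

/-- An arc that starts at an outer vertex runs through consecutive outer darts. -/
theorem IsArc.runsFrom [Finite V] (hB : IsBlock B) (ha : E.IsOuterDart a) {x y : V}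
    {W : B.Walk x y} (hW : E.IsArc W) {i : ℕ} (hx : x = E.outVert a i) :
    E.RunsFrom a i W.length W ∧ y = E.outVert a (i + W.length) ∧ W.length ≤ E.lastIndex a := by
  have key : ∀ {x y : V} (W : B.Walk x y) (i : ℕ), (∀ d ∈ W.darts, E.IsOuterDart d) →
      x = E.outVert a i → E.RunsFrom a i W.length W ∧ y = E.outVert a (i + W.length) := by
    intro x y W
    induction W with
    | nil => exact fun i _ h => ⟨by simp [RunsFrom], h⟩
    | @cons x z y h W ih =>
      intro i hd hx
      -- A vertex is the tail of at most one outer dart, so the arc has no choice.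
      have h0 : (⟨(x, z), h⟩ : B.Dart) = E.outDart a i :=
        IsOuterDart.eq_of_fst_eq E hB (hd _ (by simp)) (E.isOuterDart_outDart ha i) hx
      have hz : z = E.outVert a (i + 1) := by
        rw [← outDart_snd, ← h0]
      obtain ⟨h1, h2⟩ := ih (i + 1) (fun d hd' => hd d (by simp [hd'])) hz
      refine ⟨?_, h2.trans (by rw [Walk.length_cons]; congr 1; omega)⟩
      rw [RunsFrom] at h1 ⊢
      rw [Walk.darts_cons, h1, Walk.length_cons, List.range_succ_eq_map, List.map_cons,
        List.map_map, h0]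
      congr 1
      refine List.map_congr_left fun t _ => ?_
      simp only [Function.comp, Nat.succ_eq_add_one]
      congr 1; omega
  obtain ⟨h1, h2⟩ := key W i hW.2 hx
  refine ⟨h1, h2, ?_⟩
  by_contra hlt
  have hs := hW.1.support_nodup
  rw [h1.support_eq hx, List.nodup_map_iff_inj_on List.nodup_range] at hs
  -- A longer arc would have both positions 0 and `lastIndex + 1`, where the same vertex occurs.
  have := hs 0 (by simp) (E.lastIndex a + 1) (by rw [List.mem_range]; omega)
    (by rw [Nat.add_zero, outVert_add_period])
  omega

end Cycle

end PlaneEmbedding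
-- A discrete Jordan curve argument.
namespace PlaneEmbedding

variable {V : Type*} {B : SimpleGraph V} (E : PlaneEmbedding B)

/-- Two disjoint connected subgraphs cannot join interlacing pairs of outer vertices. -/
theorem not_crossing [Finite V] (hB : IsBlock B) {a : B.Dart} (ha : E.IsOuterDart a)
    {i j k l : ℕ} (hij : i < j) (hjk : j < k) (hkl : k < l) (hl : l ≤ E.lastIndex a)
    {X Y : Set V} (hX : (B.induce X).Preconnected) (hY : (B.induce Y).Preconnected)
    (hXY : Disjoint X Y) (hi : E.outVert a i ∈ X) (hk : E.outVert a k ∈ X)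
    (hj : E.outVert a j ∈ Y) (hlY : E.outVert a l ∈ Y) : False := by
  classical
  obtain ⟨L, rfl⟩ : ∃ L, k = i + L := ⟨k - i, by omega⟩
  have hdis : ∀ z, z ∈ X → z ∈ Y → False := fun z h1 h2 => Set.disjoint_left.1 hXY h1 h2
  have : Finite B.Dart := Finite.of_injective _ (Dart.toProd_injective)
  obtain ⟨Q, hQp, hQ⟩ := exists_path_of_preconnected hX hi hk
  obtain ⟨W, hW⟩ := E.exists_runsFrom (a := a) i L
  -- The closed walk crosses `X` along `Q` and returns along `C`. At vertices of `Y` only the part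
  -- on `C` can be met.
  obtain ⟨s, hf, hr, hc⟩ := E.exists_side (Q.append W.reverse)
  have hs := fun {d e : B.Dart} => E.side_eq_of_isOuterDart hf (d := d) (e := e)
  set t : B.Dart → ZMod 2 := fun d => ((Q.append W.reverse).edges.count d.edge : ZMod 2) with ht
  have hcount : ∀ d : B.Dart, d.fst ∈ Y → t d = (W.edges.count d.edge : ZMod 2) := by
    intro d hd
    have : d.edge ∉ Q.edges := fun h =>
      hdis _ (hQ _ (Q.fst_mem_support_of_mem_edges (h : s(d.fst, d.snd) ∈ Q.edges))) hd
    simp [ht, Walk.edges_append, Walk.edges_reverse, List.count_eq_zero_of_not_mem this]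
  have hmem : ∀ d : B.Dart, d.edge ∈ W.edges →
      ∃ r < L, d = E.outDart a (i + r) ∨ d = (E.outDart a (i + r)).symm := by
    intro d hd
    obtain ⟨e, he, hde⟩ := List.mem_map.1 hd
    obtain ⟨r, hr, rfl⟩ := hW.mem_darts.1 he
    exact ⟨r, hr, (dart_edge_eq_iff _ _).1 hde.symm⟩
  have hzero : ∀ d : B.Dart, d.fst ∈ Y → d.edge ∉ W.edges → t d = 0 := by
    intro d hd h
    rw [hcount d hd, List.count_eq_zero_of_not_mem h, Nat.cast_zero]
  have hsupp : ∀ d : B.Dart, d.edge ∈ W.edges → d.fst ∈ W.support := fun d h =>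
    W.fst_mem_support_of_mem_edges (h : s(d.fst, d.snd) ∈ W.edges)
  have hspread : ∀ d : B.Dart, d.fst ∈ Y → d.fst ∉ W.support → s d = s a →
      ∀ e : B.Dart, e.fst = d.fst → s e = s a := by
    intro d hd hdW hda e he
    obtain ⟨n, rfl⟩ := (E.rot_sameCycle d e he.symm).exists_nat_pow_eq
    rw [← hda]
    refine E.side_pow_rot hr hc n fun r _ => hzero _ ?_ fun h => hdW ?_
    · rw [E.pow_rot_fst]; exact hd
    · have := hsupp _ h; rwa [E.pow_rot_fst] at this
  have hsup := fun {z : V} => hW.mem_support rfl (z := z)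
  -- The invariant carried along walks in `Y`: the vertex is off `W` and all its darts are on the
  -- side of the outer face. It holds at index `l` and fails at index `j`, which is on `W`.
  let p : V → Prop := fun y => y ∉ W.support ∧ ∀ d : B.Dart, d.fst = y → s d = s a
  have hstep : ∀ y y', y ∈ Y → y' ∈ Y → B.Adj y y' → p y → p y' := by
    intro y y' hy hy' hadj ⟨hyW, hys⟩
    let d : B.Dart := ⟨(y, y'), hadj⟩
    have hd0 : t d = 0 := hzero d hy fun h => hyW (hsupp d h)
    have hds : s d.symm = s a := by
      have h := hc d
      rw [← hys d rfl]
      exact (CharTwo.add_eq_zero.1 (h.trans hd0)).symm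
    by_cases hy'W : y' ∈ W.support
    · exfalso
      obtain ⟨r, hr', hyr⟩ := hsup.1 hy'W
      have hr0 : r ≠ 0 := by rintro rfl; exact hdis _ hi (hyr ▸ hy')
      have hrL : r ≠ L := by rintro rfl; exact hdis _ hk (hyr ▸ hy')
      obtain ⟨r, rfl⟩ := Nat.exists_eq_succ_of_ne_zero hr0
      -- If `y'` were an inner vertex of `W`, then `f` is the reversed dart of `C` that enters `y'`,
      -- and its rotation successor is the dart of `C` that leaves `y'`. Rotating from `d.symm`, one
      -- meets `f` before any other edge of `W`, so `f` is on the outer side.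
      let f := (E.outDart a (i + r)).symm
      have hff : f.fst = y' := by rw [hyr]; exact E.outDart_snd a _
      have hrotf : E.rot f = E.outDart a (i + r.succ) := by
        change _ = E.outDart a (i + r + 1)
        rw [outDart_succ, faceNext_apply]
      have hex : ∃ n, (E.rot ^ n) d.symm = f :=
        (E.rot_sameCycle d.symm f hff.symm).exists_nat_pow_eq
      have hmin := fun n (hn : n < Nat.find hex) => Nat.find_min hex hn
      have hspec := Nat.find_spec hex
      set n := Nat.find hex
      have h1 : s ((E.rot ^ n) d.symm) = s d.symm := by
        refine E.side_pow_rot hr hc n fun q hq => ?_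
        have hqf : ((E.rot ^ q) d.symm).fst = y' := E.pow_rot_fst _ _
        refine hzero _ (hqf ▸ hy') fun h => ?_
        obtain ⟨r', hr'', h' | h'⟩ := hmem _ h
        · have h2 : y' = E.outVert a (i + r') := by rw [← hqf, h']; rfl
          have h3 := E.outVert_inj hB ha (by omega) (by omega) (hyr.symm.trans h2)
          rw [← h3] at h'
          -- The leaving dart cannot come before `f`: it is not `d.symm`, since `y` is off `W`, and
          -- otherwise the preceding dart is already `f`.
          rcases Nat.eq_zero_or_pos q with rfl | hq0
          · refine hyW (hsup.2 ⟨r + 2, by omega, ?_⟩)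
            have : d.symm.snd = (E.outDart a (i + (r + 1))).snd := by
              rw [← h']; simp
            rw [outDart_snd] at this
            exact this
          · obtain ⟨q, rfl⟩ := Nat.exists_eq_succ_of_ne_zero hq0.ne'
            rw [Nat.succ_eq_add_one, pow_succ', Equiv.Perm.mul_apply,
              ← hrotf] at h'
            exact hmin q (by omega) (E.rot.injective h')
        · have h2 : y' = E.outVert a (i + r' + 1) := by
            rw [← hqf, h']; exact E.outDart_snd a _
          have h3 := E.outVert_inj hB ha (by omega) (by omega) (hyr.symm.trans h2)
          have h4 : r' = r := by omega
          exact hmin q hq (by rw [h', h4])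
      rw [hspec, hds] at h1
      have h2 : t f = 1 := by
        rw [hcount f (hff ▸ hy')]
        have h3 : f.edge ∈ W.edges :=
          List.mem_map.2 ⟨_, hW.mem_darts.2 ⟨r, by omega, rfl⟩, (Dart.edge_symm _).symm⟩
        rw [List.count_eq_one_of_mem (hW.isPath hB ha rfl (by omega)).isTrail.edges_nodup h3,
          Nat.cast_one]
      -- The edge of `f` is used exactly once, so `f` and its reversal are on different sides; but
      -- the reversal is an outer dart.
      have h3 := hc f
      rw [h1, show f.symm = E.outDart a (i + r) from Dart.symm_symm _,
        hs (E.isOuterDart_outDart ha _) ha, CharTwo.add_self_eq_zero] at h3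
      exact absurd (h3.trans h2) (by decide)
    · exact ⟨hy'W, hspread d.symm hy' hy'W hds⟩
  have hbase : p (E.outVert a l) := by
    have h1 : E.outVert a l ∉ W.support := by
      intro h
      obtain ⟨r, hr', h⟩ := hsup.1 h
      have := E.outVert_inj hB ha (by omega) (by omega) h
      omega
    exact ⟨h1, hspread (E.outDart a l) hlY h1 (hs (E.isOuterDart_outDart ha _) ha)⟩
  obtain ⟨w, _, hw⟩ := exists_path_of_preconnected hY hlY hj
  have hall : ∀ {x y : V} (w : B.Walk x y), (∀ z ∈ w.support, z ∈ Y) → p x → p y := by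
    intro x y w
    induction w with
    | nil => exact fun _ h => h
    | cons h w ih =>
      intro hz hp
      exact ih (fun z hz' => hz z (by simp [hz']))
        (hstep _ _ (hz _ (by simp)) (hz _ (by simp)) h hp)
  exact (hall w hw hbase).1 (hsup.2 ⟨j - i, by omega, by congr 1; omega⟩)

end PlaneEmbedding

/-! ### Components, bridges and separators in a block. -/

section Components

variable {V : Type*} {B : SimpleGraph V}

/-- The vertices that can be reached from `x` without meeting `T`. -/
def offComponent (B : SimpleGraph V) (T : Set V) (x : V) : Set V :=
  {y | ∃ p : B.Walk x y, ∀ z ∈ p.support, z ∉ T}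

/-- All neighbours of vertices of `A` are in `A` or in `T`. -/
def BoundedBy (B : SimpleGraph V) (A T : Set V) : Prop :=
  ∀ k ∈ A, ∀ x, B.Adj k x → x ∈ A ∨ x ∈ T

theorem BoundedBy.mem_of_walk {A T : Set V} (h : BoundedBy B A T) {x y : V} (p : B.Walk x y)
    (hx : x ∈ A) (hp : ∀ z ∈ p.support, z ∉ T) : y ∈ A := by
  induction p with
  | nil => exact hx
  | cons hadj p ih =>
    refine ih ((h _ hx _ hadj).resolve_right (hp _ (by simp))) fun z hz => hp z (by simp [hz])

theorem mem_offComponent_self {T : Set V} {x : V} (hx : x ∉ T) : x ∈ offComponent B T x :=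
  ⟨Walk.nil, by simpa using hx⟩

theorem notMem_of_mem_offComponent {T : Set V} {x y : V} (h : y ∈ offComponent B T x) :
    y ∉ T := by
  obtain ⟨p, hp⟩ := h
  exact hp _ p.end_mem_support

theorem mem_offComponent_symm {T : Set V} {x y : V} (h : y ∈ offComponent B T x) :
    x ∈ offComponent B T y := by
  obtain ⟨p, hp⟩ := h
  exact ⟨p.reverse, by simpa using hp⟩

theorem mem_offComponent_trans {T : Set V} {x y z : V} (h : y ∈ offComponent B T x)
    (h' : z ∈ offComponent B T y) : z ∈ offComponent B T x := by
  obtain ⟨p, hp⟩ := h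
  obtain ⟨q, hq⟩ := h'
  refine ⟨p.append q, fun w hw => ?_⟩
  rcases (Walk.mem_support_append_iff _ _).1 hw with hw | hw
  exacts [hp w hw, hq w hw]

theorem offComponent_eq {T : Set V} {x y : V} (h : y ∈ offComponent B T x) :
    offComponent B T y = offComponent B T x :=
  Set.ext fun _ => ⟨mem_offComponent_trans h, mem_offComponent_trans (mem_offComponent_symm h)⟩

theorem boundedBy_offComponent (T : Set V) (x : V) : BoundedBy B (offComponent B T x) T := by
  intro k hk y hky
  by_cases hy : y ∈ T
  · exact Or.inr hy
  · refine Or.inl (mem_offComponent_trans hk ⟨Walk.cons hky Walk.nil, ?_⟩)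
    simpa using ⟨notMem_of_mem_offComponent hk, hy⟩

theorem support_subset_offComponent {T : Set V} {x y : V} (p : B.Walk x y)
    (hp : ∀ z ∈ p.support, z ∉ T) : ∀ z ∈ p.support, z ∈ offComponent B T x := by
  classical
  exact fun z hz => ⟨p.takeUntil z hz, fun w hw => hp w (p.support_takeUntil_subset_support hz hw)⟩

theorem reachable_induce_of_walk {X : Set V} {x y : V} (p : B.Walk x y)
    (hp : ∀ z ∈ p.support, z ∈ X) (hx : x ∈ X) (hy : y ∈ X) :
    (B.induce X).Reachable ⟨x, hx⟩ ⟨y, hy⟩ := by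
  induction p with
  | nil => exact Reachable.refl _
  | @cons x z y hadj p ih =>
    have hz : z ∈ X := hp z (by simp)
    have h1 : (B.induce X).Adj ⟨x, hx⟩ ⟨z, hz⟩ := hadj
    exact h1.reachable.trans (ih (fun w hw => hp w (by simp [hw])) hz hy)

theorem preconnected_induce_of_walks {X : Set V} {x : V}
    (h : ∀ y ∈ X, ∃ p : B.Walk x y, ∀ z ∈ p.support, z ∈ X) : (B.induce X).Preconnected := by
  rintro ⟨y, hy⟩ ⟨z, hz⟩
  obtain ⟨p, hp⟩ := h y hy
  obtain ⟨q, hq⟩ := h z hz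
  have hx : x ∈ X := hp x p.start_mem_support
  exact (reachable_induce_of_walk p hp hx hy).symm.trans (reachable_induce_of_walk q hq hx hz)

theorem preconnected_offComponent (T : Set V) (x : V) :
    (B.induce (offComponent B T x)).Preconnected :=
  preconnected_induce_of_walks (x := x) fun _ ⟨p, hp⟩ => ⟨p, support_subset_offComponent p hp⟩

/-- This translates the components in `IsBridgeOf` into vertex sets described by walks. -/
theorem image_supp_mk {T : Set V} {x : V} (hx : x ∉ T) :
    (fun y : (Tᶜ : Set V) => (y : V)) ''
      ((B.induce (Tᶜ : Set V)).connectedComponentMk ⟨x, hx⟩).supp = offComponent B T x := by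
  ext y
  constructor
  · rintro ⟨⟨y, hy⟩, h, rfl⟩
    rw [ConnectedComponent.mem_supp_iff, ConnectedComponent.eq] at h
    obtain ⟨p⟩ := h.symm
    refine ⟨p.map (Embedding.induce (G := B) (Tᶜ : Set V)).toHom, fun z hz => ?_⟩
    erw [Walk.support_map] at hz
    obtain ⟨z', _, rfl⟩ := List.mem_map.1 hz
    exact z'.2
  · rintro ⟨p, hp⟩
    refine ⟨⟨y, hp _ p.end_mem_support⟩, ?_, rfl⟩
    rw [ConnectedComponent.mem_supp_iff, ConnectedComponent.eq]
    exact (reachable_induce_of_walk p hp _ _).symm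

/-- In a block, no single vertex separates. -/
theorem IsBlock.not_boundedBy_singleton (hB : IsBlock B) {A : Set V} {y z w : V}
    (h : BoundedBy B A {y}) (hy : y ∉ A) (hz : z ∈ A) (hw : w ∉ A) (hwy : w ≠ y) : False := by
  have hzy : z ≠ y := fun h => hy (h ▸ hz)
  obtain ⟨p, _, hp⟩ := exists_path_of_preconnected (hB.2 y) (x := z) (y := w) hzy hwy
  exact hw (h.mem_of_walk p hz hp)

/-- A walk from `z` that avoids `x` and `y` never leaves `A`. The vertex `w` shows that there is
something on the other side. -/
theorem isTwoSeparator_of_boundedBy {A : Set V} {x y z w : V} (hxy : x ≠ y)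
    (h : BoundedBy B A {x, y}) (hz : z ∈ A) (hx : x ∉ A) (hy : y ∉ A) (hw : w ∉ A)
    (hwx : w ≠ x) (hwy : w ≠ y) : IsTwoSeparator B x y := by
  refine ⟨hxy, fun hpre => ?_⟩
  have hz' : z ∈ ({x, y}ᶜ : Set V) := by
    rintro (rfl | rfl)
    exacts [hx hz, hy hz]
  have hw' : w ∈ ({x, y}ᶜ : Set V) := by
    rintro (rfl | rfl)
    exacts [hwx rfl, hwy rfl]
  obtain ⟨p, _, hp⟩ := exists_path_of_preconnected hpre hz' hw'
  exact hw (h.mem_of_walk p hz hp)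

theorem IsTwoSeparator.exists_notMem {x y : V} (h : IsTwoSeparator B x y) (z : V) :
    ∃ w, w ∉ ({x, y} : Set V) ∧ w ∉ offComponent B {x, y} z := by
  by_contra! hall
  refine h.2 ?_
  rintro ⟨s, hs⟩ ⟨t, ht⟩
  obtain ⟨p, hp⟩ := mem_offComponent_trans (mem_offComponent_symm (hall s hs)) (hall t ht)
  exact reachable_induce_of_walk p hp _ _

/-- In a block, both vertices of a 2-separator are joined to each of its components. -/
theorem IsBlock.exists_adj_left (hB : IsBlock B) {A : Set V} {x y z w : V}
    (h : BoundedBy B A {x, y}) (hz : z ∈ A) (hy : y ∉ A) (hw : w ∉ A)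
    (hwy : w ≠ y) : ∃ k ∈ A, B.Adj k x := by
  by_contra! hno
  refine hB.not_boundedBy_singleton (A := A) (fun k hk t hkt => ?_) hy hz hw hwy
  rcases h k hk t hkt with h' | rfl | h'
  · exact Or.inl h'
  · exact absurd hkt (hno k hk)
  · exact Or.inr h'

/-- Since `w` is on another side, the component would have a single attachment if it missed `x` or
`y`. The closed-up component is a connected set joining `x` and `y`, as needed for `not_crossing`.
-/
theorem IsBlock.preconnected_insert_pair (hB : IsBlock B) {x y z w : V}
    (hz : z ∉ ({x, y} : Set V)) (hw : w ∉ ({x, y} : Set V)) (hwz : w ∉ offComponent B {x, y} z) :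
    (B.induce (offComponent B {x, y} z ∪ {x, y})).Preconnected := by
  have hb := boundedBy_offComponent (B := B) {x, y} z
  have hzz := mem_offComponent_self (B := B) hz
  have hx : x ∉ offComponent B {x, y} z := fun h => notMem_of_mem_offComponent h (by simp)
  have hy : y ∉ offComponent B {x, y} z := fun h => notMem_of_mem_offComponent h (by simp)
  simp only [Set.mem_insert_iff, Set.mem_singleton_iff, not_or] at hw
  have hext : ∀ t, t ∈ ({x, y} : Set V) → (∃ k ∈ offComponent B {x, y} z, B.Adj k t) →
      ∃ p : B.Walk z t, ∀ s ∈ p.support, s ∈ offComponent B {x, y} z ∪ {x, y} := by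
    rintro t ht ⟨k, ⟨p, hp⟩, hkt⟩
    refine ⟨p.concat hkt, fun s hs => ?_⟩
    rw [Walk.support_concat, List.mem_append, List.mem_singleton] at hs
    rcases hs with hs | rfl
    · exact Or.inl (support_subset_offComponent p hp s hs)
    · exact Or.inr ht
  refine preconnected_induce_of_walks (x := z) ?_
  rintro t (⟨p, hp⟩ | rfl | rfl)
  · exact ⟨p, fun s hs => Or.inl (support_subset_offComponent p hp s hs)⟩
  · exact hext _ (by simp) (hB.exists_adj_left hb hzz hy hwz hw.2)
  · exact hext _ (by simp) (hB.exists_adj_left (Set.pair_comm x t ▸ hb) hzz hx hwz hw.1)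

/-- The bridge that contains a given vertex outside `H`. -/
theorem IsBridgeOf.eq_closedStar {H J : B.Subgraph} (hJ : IsBridgeOf H J) {x : V}
    (hx : x ∉ H.verts) (hxJ : x ∈ J.verts) : J = closedStar B (offComponent B H.verts x) := by
  rcases hJ with ⟨y, z, h, hy, hz, _, rfl⟩ | ⟨K, rfl⟩
  · rcases hxJ with rfl | rfl
    exacts [absurd hy hx, absurd hz hx]
  · induction K using ConnectedComponent.ind with
    | h y =>
      obtain ⟨y, hy⟩ := y
      rw [image_supp_mk hy] at hxJ ⊢
      rcases hxJ with h | ⟨k, hk, hkx⟩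
      · rw [offComponent_eq h]
      · have := (boundedBy_offComponent _ _ k hk x hkx).resolve_right hx
        rw [offComponent_eq this]

theorem isBridgeOf_closedStar {H : B.Subgraph} {x : V} (hx : x ∉ H.verts) :
    IsBridgeOf H (closedStar B (offComponent B H.verts x)) :=
  Or.inr ⟨(B.induce (H.vertsᶜ : Set V)).connectedComponentMk ⟨x, hx⟩, by rw [image_supp_mk hx]⟩

/-- A non-trivial bridge contains a component of the complement. -/
theorem IsBridgeOf.exists_eq_closedStar {H J : B.Subgraph} (hJ : IsBridgeOf H J)
    (hn : ¬ IsTrivialBridge J) :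
    ∃ x, x ∉ H.verts ∧ J = closedStar B (offComponent B H.verts x) := by
  rcases hJ with ⟨y, z, h, hy, hz, _, rfl⟩ | ⟨K, rfl⟩
  · exact absurd ⟨y, z, h, rfl⟩ hn
  · induction K using ConnectedComponent.ind with
    | h y => exact ⟨y, y.2, by rw [image_supp_mk y.2]⟩

theorem mem_attachments_closedStar {H : B.Subgraph} {x z : V} :
    z ∈ attachments H (closedStar B (offComponent B H.verts x)) ↔
      z ∈ H.verts ∧ ∃ k ∈ offComponent B H.verts x, B.Adj k z := by
  constructor
  · rintro ⟨h | h, hz⟩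
    · exact absurd hz (notMem_of_mem_offComponent h)
    · exact ⟨hz, h⟩
  · rintro ⟨hz, h⟩
    exact ⟨Or.inr h, hz⟩

theorem closedStar_mono {K K' : Set V} (h : K ⊆ K') : closedStar B K ≤ closedStar B K' := by
  refine ⟨?_, fun x y ⟨hxy, hK⟩ => ⟨hxy, hK.imp (@h x) (@h y)⟩⟩
  rintro x (hx | ⟨k, hk, hkx⟩)
  exacts [Or.inl (h hx), Or.inr ⟨k, h hk, hkx⟩]

end Components
-- What an interval of outer vertices cuts off.
namespace PlaneEmbedding

variable {V : Type*} {B : SimpleGraph V} (E : PlaneEmbedding B)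

/-- The vertices outside `{c, d}` that are joined in `B - {c, d}` to inner vertices of `cCd`,
where `c` and `d` are the outer vertices with the indices `i` and `j`. -/
def inside (a : B.Dart) (i j : ℕ) : Set V :=
  {x | ∃ t, i < t ∧ t < j ∧ x ∈ offComponent B {E.outVert a i, E.outVert a j} (E.outVert a t)}

section Inside

variable {a : B.Dart} {i j : ℕ}

theorem boundedBy_inside :
    BoundedBy B (E.inside a i j) {E.outVert a i, E.outVert a j} := by
  rintro k ⟨t, hit, htj, hk⟩ x hkx
  exact (boundedBy_offComponent _ _ k hk x hkx).imp (fun h => ⟨t, hit, htj, h⟩) id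

theorem notMem_pair_of_mem_inside {x : V} (hx : x ∈ E.inside a i j) :
    x ≠ E.outVert a i ∧ x ≠ E.outVert a j := by
  obtain ⟨t, _, _, h⟩ := hx
  have := notMem_of_mem_offComponent h
  simpa using this

theorem outVert_notMem_pair [Finite V] (hB : IsBlock B) (ha : E.IsOuterDart a)
    (hi : i ≤ E.lastIndex a) (hj : j ≤ E.lastIndex a)
    {t : ℕ} (ht : t ≤ E.lastIndex a) (hit : t ≠ i) (htj : t ≠ j) :
    E.outVert a t ∉ ({E.outVert a i, E.outVert a j} : Set V) := by
  rintro (h | h)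
  · exact hit (E.outVert_inj hB ha ht hi h)
  · exact htj (E.outVert_inj hB ha ht hj h)

theorem outVert_mem_inside [Finite V] (hB : IsBlock B) (ha : E.IsOuterDart a)
    (hj : j ≤ E.lastIndex a) {t : ℕ} (hit : i < t) (htj : t < j) :
    E.outVert a t ∈ E.inside a i j :=
  ⟨t, hit, htj, mem_offComponent_self
    (E.outVert_notMem_pair hB ha (by omega) hj (by omega) hit.ne' htj.ne)⟩

/-- Consecutive inner vertices of the interval are adjacent, so all of them are in one component; `i
+ 1 < j` ensures that there is one. -/
theorem inside_eq [Finite V] (hB : IsBlock B) (ha : E.IsOuterDart a)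
    (hj : j ≤ E.lastIndex a) (hij : i + 1 < j) :
    E.inside a i j = offComponent B {E.outVert a i, E.outVert a j} (E.outVert a (i + 1)) := by
  have key : ∀ t, i + 1 + t < j → E.outVert a (i + 1 + t) ∈
      offComponent B {E.outVert a i, E.outVert a j} (E.outVert a (i + 1)) := by
    intro t
    induction t with
    | zero =>
      exact fun h => mem_offComponent_self (x := E.outVert a (i + 1))
        (E.outVert_notMem_pair hB ha (by omega) hj (by omega) (by omega) (by omega))
    | succ t ih =>
      intro h
      exact (boundedBy_offComponent _ _ _ (ih (by omega)) _ (E.adj_outVert a _)).resolve_right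
        (E.outVert_notMem_pair hB ha (by omega) hj (by omega) (by omega) (by omega))
  ext x
  constructor
  · rintro ⟨t, hit, htj, hx⟩
    obtain ⟨r, rfl⟩ : ∃ r, t = i + 1 + r := ⟨t - (i + 1), by omega⟩
    exact mem_offComponent_trans (key r htj) hx
  · exact fun hx => ⟨i + 1, by omega, hij, hx⟩

/-- For a 2-separator `{c, d}`, no vertex of `C` outside `cCd` is joined to the inside. -/
theorem outVert_notMem_inside [Finite V] (hB : IsBlock B) (ha : E.IsOuterDart a)
    (hj : j ≤ E.lastIndex a) (hsep : IsTwoSeparator B (E.outVert a i) (E.outVert a j))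
    {t : ℕ} (ht : t ≤ E.lastIndex a) (hout : t < i ∨ j < t) :
    E.outVert a t ∉ E.inside a i j := by
  rintro ⟨r, hir, hrj, hx⟩
  -- A second component, together with the pair, joins `i` to `j`, while the component of `r` would
  -- join `r` to `t`. These pairs interlace.
  obtain ⟨z, hz, hzr⟩ := hsep.exists_notMem (E.outVert a r)
  have hr : E.outVert a r ∉ ({E.outVert a i, E.outVert a j} : Set V) :=
    E.outVert_notMem_pair hB ha (by omega) hj (by omega) hir.ne' hrj.ne
  have hX := hB.preconnected_insert_pair hz hr fun h => hzr (mem_offComponent_symm h)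
  have hY := preconnected_offComponent (B := B) {E.outVert a i, E.outVert a j} (E.outVert a r)
  have hXY : Disjoint (offComponent B {E.outVert a i, E.outVert a j} z ∪
      {E.outVert a i, E.outVert a j})
      (offComponent B {E.outVert a i, E.outVert a j} (E.outVert a r)) := by
    rw [Set.disjoint_left]
    rintro w (hw | hw) hw'
    · exact hzr (mem_offComponent_trans hw' (mem_offComponent_symm hw))
    · exact notMem_of_mem_offComponent hw' hw
  rcases hout with h | h
  · exact E.not_crossing hB ha h hir hrj hj hY hX hXY.symm hx (mem_offComponent_self hr)
      (Or.inr (by simp)) (Or.inr (by simp))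
  · exact E.not_crossing hB ha hir hrj h ht hX hY hXY (Or.inr (by simp)) (Or.inr (by simp))
      (mem_offComponent_self hr) hx

end Inside

/-! ### Arcs as intervals of indices. -/

section Arcs

variable {a : B.Dart}

/-- Arcs with the same endvertices have the same length. -/
theorem IsArc.length_eq [Finite V] (hB : IsBlock B) {x y : V} (hx : E.OnOuter x)
    {W W' : B.Walk x y} (hW : E.IsArc W) (hW' : E.IsArc W') : W.length = W'.length := by
  obtain ⟨t, _, rfl⟩ := (E.onOuter_iff (a := E.outer) (Equiv.Perm.SameCycle.refl _ _)).1 hx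
  have key : ∀ {W W' : B.Walk (E.outVert E.outer t) y}, E.IsArc W → E.IsArc W' →
      W.length < W'.length → False := by
    intro W W' hW hW' hlt
    obtain ⟨h1, h2, h3⟩ := IsArc.runsFrom E hB (Equiv.Perm.SameCycle.refl _ _) hW rfl
    obtain ⟨h1', h2', h3'⟩ := IsArc.runsFrom E hB (Equiv.Perm.SameCycle.refl _ _) hW' rfl
    have hs := hW'.1.support_nodup
    rw [h1'.support_eq rfl, List.nodup_map_iff_inj_on List.nodup_range] at hs
    have := hs W.length (by rw [List.mem_range]; omega) W'.length (by simp) (h2.symm.trans h2')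
    omega
  rcases lt_trichotomy W.length W'.length with h | h | h
  exacts [(key hW hW' h).elim, h, (key hW' hW h).elim]

/-- An arc that does not use the dart `a` is an interval of indices. -/
theorem IsArc.exists_interval [Finite V] (hB : IsBlock B) (ha : E.IsOuterDart a) {x y : V}
    {W : B.Walk x y} (hW : E.IsArc W) (hx : E.OnOuter x) (haW : a ∉ W.darts) :
    ∃ i, i + W.length ≤ E.lastIndex a ∧ x = E.outVert a i ∧ y = E.outVert a (i + W.length) ∧
      E.RunsFrom a i W.length W := by
  obtain ⟨i, hi, hxi⟩ := (E.onOuter_iff ha).1 hx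
  obtain ⟨h1, h2, _⟩ := IsArc.runsFrom E hB ha hW hxi
  refine ⟨i, ?_, hxi, h2, h1⟩
  by_contra hlt
  refine haW (h1.mem_darts.2 ⟨E.lastIndex a - i, by omega, ?_⟩)
  rw [show i + (E.lastIndex a - i) = E.lastIndex a by omega, outDart_lastIndex]

theorem lastIndex_pos [Finite V] : 0 < E.lastIndex a := by
  by_contra h
  have h1 := E.adj_outVert a 0
  have h2 := E.outVert_add_period a 0
  rw [show E.lastIndex a = 0 by omega] at h2
  rw [h2] at h1
  exact h1.ne rfl

/-- The structure of the bridge `B_{cd}^+`. -/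
theorem IsPlusBridge.verts_subset_or_eq [Finite V] (hB : IsBlock B) (ha : E.IsOuterDart a)
    {i L : ℕ} (hL : 0 < L) (hiL : i + L ≤ E.lastIndex a) {J : B.Subgraph}
    (hJ : E.IsPlusBridge (E.outVert a i) (E.outVert a (i + L)) J) :
    J.verts ⊆ {E.outVert a i, E.outVert a (i + L)} ∨
      (1 < L ∧ J = closedStar B (E.inside a i (i + L))) := by
  obtain ⟨hJ, W, hW, hWJ⟩ := hJ
  obtain ⟨W', hW'⟩ := E.exists_runsFrom (a := a) i L
  have hlen := IsArc.length_eq E hB ⟨_, E.isOuterDart_outDart ha i, rfl⟩ hW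
    (hW'.isArc hB ha rfl hiL)
  replace hlen : W.length = L := hlen.trans hW'.length_eq
  have hrun := (IsArc.runsFrom E hB ha hW rfl).1
  rw [hlen] at hrun
  rcases Nat.lt_or_ge 1 L with h1 | h1
  · right
    refine ⟨h1, ?_⟩
    rw [E.inside_eq hB ha hiL (by omega)]
    refine hJ.eq_closedStar
      (E.outVert_notMem_pair hB ha (by omega) (by omega) (by omega) (by omega) (by omega)) ?_
    exact hWJ.1 ((W.mem_verts_toSubgraph).2 ((hrun.mem_support rfl).2 ⟨1, by omega, rfl⟩))
  · left
    obtain rfl : L = 1 := by omega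
    -- Every edge of a bridge that comes from a component has an end outside the pair, so the bridge
    -- containing the edge `cd` is this edge.
    rcases hJ with ⟨x, y, h, hx, hy, _, rfl⟩ | ⟨K, rfl⟩
    · rintro z (rfl | rfl)
      exacts [hx, hy]
    · exfalso
      have hmem : E.outDart a i ∈ W.darts := hrun.mem_darts.2 ⟨0, by omega, rfl⟩
      have hadj : W.toSubgraph.Adj (E.outVert a i) (E.outVert a (i + 1)) := by
        rw [Walk.adj_toSubgraph_iff_mem_edges]
        refine List.mem_map.2 ⟨_, hmem, ?_⟩
        change s((E.outDart a i).fst, (E.outDart a i).snd) = _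
        rw [outDart_snd]; rfl
      rcases (hWJ.2 hadj).2 with ⟨z, _, hz⟩ | ⟨z, _, hz⟩
      · exact z.2 (Or.inl hz)
      · exact z.2 (Or.inr hz)

theorem isPlusBridge_closedStar_inside [Finite V] (hB : IsBlock B) (ha : E.IsOuterDart a)
    {i j : ℕ} (hij : i + 1 < j) (hj : j ≤ E.lastIndex a) :
    E.IsPlusBridge (E.outVert a i) (E.outVert a j) (closedStar B (E.inside a i j)) := by
  obtain ⟨L, rfl⟩ : ∃ L, j = i + L := ⟨j - i, by omega⟩
  constructor
  · rw [E.inside_eq hB ha hj hij]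
    exact isBridgeOf_closedStar (H := pairSubgraph B _ _)
      (E.outVert_notMem_pair hB ha (by omega) (by omega) (by omega) (by omega) (by omega))
  obtain ⟨W, hW⟩ := E.exists_runsFrom (a := a) i L
  have hin : ∀ t, 0 < t → t < L → E.outVert a (i + t) ∈ E.inside a i (i + L) := fun t h0 ht =>
    E.outVert_mem_inside hB ha hj (by omega) (by omega)
  refine ⟨W, hW.isArc hB ha rfl hj, ?_, ?_⟩
  · intro z hz
    obtain ⟨t, ht, rfl⟩ := (hW.mem_support rfl).1 (W.mem_verts_toSubgraph.1 hz)
    rcases Nat.eq_zero_or_pos t with rfl | h0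
    · exact Or.inr ⟨_, hin 1 (by omega) (by omega), (E.adj_outVert a i).symm⟩
    rcases ht.eq_or_lt with rfl | ht
    · obtain ⟨t, rfl⟩ := Nat.exists_eq_succ_of_ne_zero h0.ne'
      exact Or.inr ⟨_, hin t (by omega) (by omega), E.adj_outVert a (i + t)⟩
    · exact Or.inl (hin t h0 ht)
  · intro x y hxy
    refine ⟨W.toSubgraph.adj_sub hxy, ?_⟩
    rw [Walk.adj_toSubgraph_iff_mem_edges] at hxy
    obtain ⟨d, hd, hde⟩ := List.mem_map.1 hxy
    obtain ⟨t, ht, rfl⟩ := hW.mem_darts.1 hd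
    have : (E.outDart a (i + t)).edge = s(E.outVert a (i + t), E.outVert a (i + (t + 1))) := by
      change s((E.outDart a (i + t)).fst, (E.outDart a (i + t)).snd) = _
      rw [outDart_snd]; rfl
    rw [this, Sym2.eq_iff] at hde
    rcases Nat.eq_zero_or_pos t with rfl | h0
    · have := hin 1 (by omega) (by omega)
      rcases hde with ⟨rfl, rfl⟩ | ⟨rfl, rfl⟩
      exacts [Or.inr this, Or.inl this]
    · have := hin t h0 ht
      rcases hde with ⟨rfl, rfl⟩ | ⟨rfl, rfl⟩
      exacts [Or.inl this, Or.inr this]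

theorem mem_edges_of_mem_darts_of_le {x y x' y' : V} {W : B.Walk x y} {W' : B.Walk x' y'}
    (h : W.toSubgraph ≤ W'.toSubgraph) {d : B.Dart} (hd : d ∈ W.darts) : d.edge ∈ W'.edges := by
  have h1 : W.toSubgraph.Adj d.fst d.snd :=
    W.adj_toSubgraph_iff_mem_edges.2 (List.mem_map.2 ⟨d, hd, rfl⟩)
  exact W'.adj_toSubgraph_iff_mem_edges.1 (h.2 h1)

/-- A path that encloses an inner vertex `v` is an interval of indices, with `v` inside. -/
theorem Encloses.exists_interval [Finite V] (hB : IsBlock B) (ha : E.IsOuterDart a) {u v : V}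
    (hv : ¬ E.OnOuter v) {x y : V} {W : B.Walk x y}
    (h : E.Encloses u a v W) :
    ∃ i, i + W.length ≤ E.lastIndex a ∧ x = E.outVert a i ∧ y = E.outVert a (i + W.length) ∧
      E.RunsFrom a i W.length W ∧ v ∈ E.inside a i (i + W.length) := by
  classical
  obtain ⟨hsep, hW, hin, J, hJ, hvJ⟩ := h
  have h0 : 0 < W.length := by
    rw [Nat.pos_iff_ne_zero]
    exact fun h => hsep.1 (Walk.eq_of_length_eq_zero h)
  have hx : E.OnOuter x := by
    cases W with
    | nil => exact absurd rfl hsep.1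
    | cons hadj W => exact ⟨⟨(_, _), hadj⟩, hW.2 _ (by simp), rfl⟩
  have hne : a ∉ W.darts → ∃ i, i + W.length ≤ E.lastIndex a ∧ x = E.outVert a i ∧
      y = E.outVert a (i + W.length) ∧ E.RunsFrom a i W.length W ∧
      v ∈ E.inside a i (i + W.length) := by
    intro haW
    obtain ⟨i, hi, hxi, hyi, hrun⟩ := IsArc.exists_interval E hB ha hW hx haW
    refine ⟨i, hi, hxi, hyi, hrun, ?_⟩
    have hout : ∀ t, v ≠ E.outVert a t := by
      rintro t rfl
      exact hv ⟨_, E.isOuterDart_outDart ha t, rfl⟩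
    have hJ' := hJ
    rw [hxi, hyi] at hJ'
    rcases IsPlusBridge.verts_subset_or_eq E hB ha h0 hi hJ' with h | ⟨_, rfl⟩
    · rcases h hvJ with h | h
      · exact absurd h (hout _)
      · exact absurd h (hout _)
    · rcases hvJ with h | ⟨k, hk, hkv⟩
      · exact h
      · rcases E.boundedBy_inside k hk v hkv with h | h | h
        · exact h
        · exact absurd h (hout _)
        · exact absurd h (hout _)
  rcases hin with ⟨X, hX, haX, hWX⟩ | hWa | ⟨X, hX, haX, hWX⟩
  · exact hne fun h => haX (mem_edges_of_mem_darts_of_le hWX h)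
  -- Inside `α` the arc is a single edge, whose plus-bridge is trivial, so `v` would be on `C`.
  · exfalso
    have hsub : W.support ⊆ [a.fst, a.snd] := by
      intro z hz
      have := hWa.1 (W.mem_verts_toSubgraph.2 hz)
      simpa [subgraphOfAdj] using this
    have hlen := (hW.1.support_nodup.subperm hsub).length_le
    rw [Walk.length_support] at hlen
    cases W with
    | nil => exact hsep.1 rfl
    | @cons _ z _ hadj W =>
      obtain rfl : z = y := Walk.eq_of_length_eq_zero (p := W) (by simpa using hlen)
      let d : B.Dart := ⟨(x, z), hadj⟩
      have hd : E.IsOuterDart d := hW.2 _ (by simp [d])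
      -- Numbering `C` from the predecessor of `d` gives `d` the index 0, whatever its position
      -- relative to `a`.
      have hd' : E.IsOuterDart (E.faceNext.symm d) :=
        hd.trans ⟨-1, by simp⟩
      have h1 : E.outDart (E.faceNext.symm d) 0 = d := E.faceNext.apply_symm_apply d
      have h2 : E.outVert (E.faceNext.symm d) 0 = x := congrArg (fun d : B.Dart => d.fst) h1
      have h3 : E.outVert (E.faceNext.symm d) (0 + 1) = z := by rw [← outDart_snd, h1]
      rw [← h2, ← h3] at hJ
      rcases IsPlusBridge.verts_subset_or_eq E hB hd' one_pos
        (by rw [zero_add]; exact E.lastIndex_pos) hJ with h | ⟨h, _⟩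
      · rcases h hvJ with h | h
        · exact hv ⟨_, E.isOuterDart_outDart hd' 0, h.symm⟩
        · exact hv ⟨_, E.isOuterDart_outDart hd' (0 + 1), h.symm⟩
      · omega
  · exact hne fun h => haX (mem_edges_of_mem_darts_of_le hWX h)

end Arcs
end PlaneEmbedding
namespace PlaneEmbedding

variable {V : Type*} {B : SimpleGraph V} (E : PlaneEmbedding B) {a : B.Dart}

theorem RunsFrom.toSubgraph_le {E : PlaneEmbedding B} {i L i' L' : ℕ} {x y x' y' : V}
    {W : B.Walk x y} {W' : B.Walk x' y'} (hW : E.RunsFrom a i L W) (hx : x = E.outVert a i)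
    (hW' : E.RunsFrom a i' L' W') (hx' : x' = E.outVert a i') (hi : i' ≤ i)
    (hL : i + L ≤ i' + L') : W.toSubgraph ≤ W'.toSubgraph := by
  constructor
  · intro z hz
    obtain ⟨t, ht, rfl⟩ := (hW.mem_support hx).1 (W.mem_verts_toSubgraph.1 hz)
    exact W'.mem_verts_toSubgraph.2
      ((hW'.mem_support hx').2 ⟨i + t - i', by omega, by congr 1; omega⟩)
  · intro z z' h
    rw [Walk.adj_toSubgraph_iff_mem_edges] at h ⊢
    obtain ⟨d, hd, hde⟩ := List.mem_map.1 h
    obtain ⟨t, ht, rfl⟩ := hW.mem_darts.1 hd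
    exact List.mem_map.2 ⟨_, hW'.mem_darts.2 ⟨i + t - i', by omega, by congr 1; omega⟩, hde⟩

/-- If `lastIndex` is 1, then `outDart 0` is the reversal of `a` and has the same edge; this is why
2 is required. -/
theorem edge_outDart_ne [Finite V] (hB : IsBlock B) (ha : E.IsOuterDart a)
    (hm : 2 ≤ E.lastIndex a) {t : ℕ} (ht : t < E.lastIndex a) :
    (E.outDart a t).edge ≠ a.edge := by
  intro h
  rcases (dart_edge_eq_iff _ _).1 h with h | h
  · have := E.outDart_inj ht.le le_rfl (h.trans (E.outDart_lastIndex a).symm)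
    omega
  · have h1 : E.outVert a t = E.outVert a 0 := by rw [outVert_zero, outVert, h]; rfl
    obtain rfl := E.outVert_inj hB ha ht.le (Nat.zero_le _) h1
    have h2 : E.outVert a 1 = E.outVert a (E.lastIndex a) := by
      rw [outVert_lastIndex, ← outDart_snd, h]; rfl
    have := E.outVert_inj hB ha (by omega) le_rfl h2
    omega

/-- The path from `r_α` to `l_α` around `C`. -/
theorem exists_runsFrom_zero [Finite V] (hB : IsBlock B) (ha : E.IsOuterDart a)
    (hm : 2 ≤ E.lastIndex a) : ∃ X : B.Walk a.snd a.fst,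
      E.RunsFrom a 0 (E.lastIndex a) X ∧ E.IsArc X ∧ a.edge ∉ X.edges := by
  have h := E.exists_runsFrom (a := a) 0 (E.lastIndex a)
  rw [zero_add, outVert_lastIndex, outVert_zero] at h
  obtain ⟨X, hX⟩ := h
  refine ⟨X, hX, hX.isArc hB ha (E.outVert_zero a).symm (by omega), fun h => ?_⟩
  obtain ⟨d, hd, hde⟩ := List.mem_map.1 h
  obtain ⟨t, ht, rfl⟩ := hX.mem_darts.1 hd
  exact E.edge_outDart_ne hB ha hm (by omega) hde

/-- If `u` is an end of `α`, then one of `uCα`, `αCu` is the whole of `C - α`, so every interval of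
indices is allowed. -/
theorem exists_encloses [Finite V] (hB : IsBlock B) (ha : E.IsOuterDart a) {u v : V}
    (hu : u = a.snd ∨ u = a.fst) {i j : ℕ} (hij : i + 1 < j) (hj : j ≤ E.lastIndex a)
    (hsep : IsTwoSeparator B (E.outVert a i) (E.outVert a j)) (hv : v ∈ E.inside a i j) :
    ∃ (x y : V) (W : B.Walk x y), E.Encloses u a v W := by
  obtain ⟨L, rfl⟩ : ∃ L, j = i + L := ⟨j - i, by omega⟩
  obtain ⟨W, hW⟩ := E.exists_runsFrom (a := a) i L
  obtain ⟨X, hX, hXa, haX⟩ := E.exists_runsFrom_zero hB ha (by omega)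
  have hle := hW.toSubgraph_le rfl hX (E.outVert_zero a).symm (Nat.zero_le _) (by omega)
  refine ⟨_, _, W, hsep, hW.isArc hB ha rfl hj, ?_, _,
    E.isPlusBridge_closedStar_inside hB ha hij hj, Or.inl hv⟩
  rcases hu with rfl | rfl
  · exact Or.inl ⟨X, hXa, haX, hle⟩
  · exact Or.inr (Or.inr ⟨X, hXa, haX, hle⟩)

/-! ### Uncrossing 2-separators between boundary points. -/

section BoundaryPoints

variable {E} {u v : V} {S : Set V}

theorem IsBoundaryPoints.subset (hS : E.IsBoundaryPoints u a v S) : {u, a.fst, a.snd} ⊆ S := by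
  rcases hS with ⟨_, rfl⟩ | ⟨_, ⟨_, _, _, _, _, _, _, rfl⟩ | ⟨_, rfl⟩⟩
  · rintro x (rfl | rfl | rfl) <;> simp
  · exact Set.subset_union_left
  · exact subset_rfl

theorem IsBoundaryPoints.mem_of_onOuter (hS : E.IsBoundaryPoints u a v S) (hv : E.OnOuter v) :
    v ∈ S := by
  rcases hS with ⟨_, rfl⟩ | ⟨h, _⟩
  · simp
  · exact absurd hv h

/-- The bridge in the definition of the boundary points, in terms of indices. -/
theorem EnclosesMinimally.exists_bridge [Finite V] (hB : IsBlock B) (ha : E.IsOuterDart a)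
    (hv : ¬ E.OnOuter v) {x y : V} {W : B.Walk x y} (hW : E.EnclosesMinimally u a v W)
    {J : B.Subgraph} (hJ : IsBridgeOf W.toSubgraph J) (hvJ : v ∈ J.verts) :
    ∃ i j, i < j ∧ j ≤ E.lastIndex a ∧ IsTwoSeparator B (E.outVert a i) (E.outVert a j) ∧
      v ∈ E.inside a i j ∧
      (∀ z, z ∈ W.toSubgraph.verts ↔ ∃ t, i ≤ t ∧ t ≤ j ∧ z = E.outVert a t) ∧
      v ∉ W.toSubgraph.verts ∧ J = closedStar B (offComponent B W.toSubgraph.verts v) := by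
  obtain ⟨i, hi, hx, hy, hrun, hvi⟩ := Encloses.exists_interval E hB ha hv hW.1
  have hmem : ∀ z, z ∈ W.toSubgraph.verts ↔
      ∃ t, i ≤ t ∧ t ≤ i + W.length ∧ z = E.outVert a t := by
    intro z
    rw [Walk.mem_verts_toSubgraph, hrun.mem_support hx]
    constructor
    · rintro ⟨t, ht, rfl⟩
      exact ⟨i + t, by omega, by omega, rfl⟩
    · rintro ⟨t, ht, ht', rfl⟩
      exact ⟨t - i, by omega, by congr 1; omega⟩
  have hvW : v ∉ W.toSubgraph.verts := by
    rw [hmem]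
    rintro ⟨t, _, _, rfl⟩
    exact hv ⟨_, E.isOuterDart_outDart ha t, rfl⟩
  have h0 : 0 < W.length := by
    rw [Nat.pos_iff_ne_zero]
    exact fun h => hW.1.1.1 (Walk.eq_of_length_eq_zero h)
  exact ⟨i, i + W.length, by omega, hi, hx ▸ hy ▸ hW.1.1, hvi, hmem, hvW,
    hJ.eq_closedStar hvW hvJ⟩

/-- If two 2-separators cross and no boundary point is between them, then their union also
gives a 2-separator. -/
theorem IsBoundaryPoints.isTwoSeparator_of_crossing [Finite V] (hB : IsBlock B)
    (ha : E.IsOuterDart a) (hS : E.IsBoundaryPoints u a v S) (hu : E.OnOuter u) (huv : u ≠ v)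
    (hends₁ : ¬ (u = a.fst ∧ v = a.snd)) (hends₂ : ¬ (u = a.snd ∧ v = a.fst))
    {p p' q q' : ℕ} (h₁ : p < p') (h₂ : p' < q) (h₃ : q < q') (h₄ : q' ≤ E.lastIndex a)
    (hsep : IsTwoSeparator B (E.outVert a p) (E.outVert a q))
    (hsep' : IsTwoSeparator B (E.outVert a p') (E.outVert a q'))
    (hfree : ∀ t, p < t → t < q' → E.outVert a t ∉ S) :
    IsTwoSeparator B (E.outVert a p) (E.outVert a q') := by
  have hinj := fun {s t : ℕ} => E.outVert_inj hB ha (s := s) (t := t)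
  have hne : E.outVert a p ≠ E.outVert a q' := fun h => by
    have := hinj (by omega) h₄ h; omega
  -- The inner ends `p'` and `q` are absorbed, since each lies inside the other separator; only `p`
  -- and `q'` remain as outside neighbours.
  let A := E.inside a p q ∪ E.inside a p' q'
  have hp'A : E.outVert a p' ∈ A := Or.inl (E.outVert_mem_inside hB ha (by omega) h₁ h₂)
  have hqA : E.outVert a q ∈ A := Or.inr (E.outVert_mem_inside hB ha (by omega) h₂ h₃)
  have hA : BoundedBy B A {E.outVert a p, E.outVert a q'} := by
    rintro k (hk | hk) x hkx
    · rcases E.boundedBy_inside k hk x hkx with h | rfl | rfl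
      · exact Or.inl (Or.inl h)
      · exact Or.inr (by simp)
      · exact Or.inl hqA
    · rcases E.boundedBy_inside k hk x hkx with h | rfl | rfl
      · exact Or.inl (Or.inr h)
      · exact Or.inl hp'A
      · exact Or.inr (by simp)
  have hout : ∀ t ≤ E.lastIndex a, t ≤ p ∨ q' ≤ t → E.outVert a t ∉ A := by
    rintro t ht hpt (h | h)
    · rcases eq_or_ne t p with rfl | htp
      · exact (E.notMem_pair_of_mem_inside h).1 rfl
      · exact E.outVert_notMem_inside hB ha (by omega) hsep ht (by omega) h
    · rcases eq_or_ne t q' with rfl | htp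
      · exact (E.notMem_pair_of_mem_inside h).2 rfl
      · exact E.outVert_notMem_inside hB ha (by omega) hsep' ht (by omega) h
  have hpA := hout p (by omega) (Or.inl le_rfl)
  have hq'A := hout q' (by omega) (Or.inr le_rfl)
  by_cases hw : ∃ w, w ∉ A ∧ w ≠ E.outVert a p ∧ w ≠ E.outVert a q'
  · obtain ⟨w, hw, hwp, hwq⟩ := hw
    exact isTwoSeparator_of_boundedBy hne hA hp'A hpA hq'A hw hwp hwq
  push Not at hw
  -- Now `p` and `q'` are the only vertices outside `A`. The ends of `α`, with the first and the
  -- last index, are outside `A` too, so they are `p` and `q'`.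
  obtain rfl : p = 0 := by
    by_contra hp0
    refine hp0 (hinj (by omega) (by omega) ?_)
    by_contra h
    have h2 := hw _ (hout 0 (by omega) (by omega)) (Ne.symm h)
    have := hinj (by omega) (by omega) h2
    omega
  obtain rfl : q' = E.lastIndex a := by
    by_contra hq0
    refine hq0 (hinj (by omega) (by omega) ?_)
    by_contra h
    refine h (hw _ (hout _ le_rfl (by omega)) fun h => ?_).symm
    have := hinj (by omega) (by omega) h
    omega
  have hfst := E.outVert_lastIndex a
  have hsnd := E.outVert_zero a
  -- As a boundary point, `u` is an end of `α`. Then `v` is not, so `v` is in `A`, and off `C`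
  -- because it would otherwise be a forbidden boundary point.
  have huS : u = a.snd ∨ u = a.fst := by
    obtain ⟨k, hk, rfl⟩ := (E.onOuter_iff ha).1 hu
    have : E.outVert a k ∈ S := hS.subset (by simp)
    rcases Nat.eq_zero_or_pos k with rfl | hk0
    · exact Or.inl hsnd
    · rcases hk.lt_or_eq with hk | rfl
      · exact absurd this (hfree k hk0 hk)
      · exact Or.inr hfst
  have hv1 : v ≠ a.snd ∧ v ≠ a.fst := by
    rcases huS with rfl | rfl
    · exact ⟨huv.symm, fun h => hends₂ ⟨rfl, h⟩⟩
    · exact ⟨fun h => hends₁ ⟨rfl, h⟩, huv.symm⟩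
  have hvA : v ∈ A := by
    by_contra h
    rw [← hfst, ← hsnd] at hv1
    exact hv1.2 (hw v h hv1.1)
  have hvo : ¬ E.OnOuter v := by
    intro hvo
    have hvS := hS.mem_of_onOuter hvo
    obtain ⟨k, hk, rfl⟩ := (E.onOuter_iff ha).1 hvo
    refine hfree k (Nat.pos_of_ne_zero ?_) (lt_of_le_of_ne hk ?_) hvS
    · rintro rfl; exact hv1.1 hsnd
    · rintro rfl; exact hv1.2 hfst
  rcases hS with ⟨h, _⟩ | ⟨_, ⟨x, y, W, J, hW, hJ, hvJ, rfl⟩ | ⟨hno, _⟩⟩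
  · exact absurd h hvo
  · obtain ⟨i, j, hij, hj, _, _, hmem, hvW, rfl⟩ := hW.exists_bridge hB ha hvo hJ hvJ
    have hb := boundedBy_offComponent (B := B) W.toSubgraph.verts v
    have hvK := mem_offComponent_self (B := B) hvW
    have hnot : ∀ t, i ≤ t → t ≤ j →
        E.outVert a t ∉ offComponent B W.toSubgraph.verts v := fun t h h' hK =>
      notMem_of_mem_offComponent hK ((hmem _).2 ⟨t, h, h', rfl⟩)
    -- Attachments of the bridge around `v` are boundary points, so only the first and the last
    -- index are possible.
    have hattach : ∀ k ∈ offComponent B W.toSubgraph.verts v, ∀ z, B.Adj k z →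
        z ∈ offComponent B W.toSubgraph.verts v ∨
          ∃ t, i ≤ t ∧ t ≤ j ∧ z = E.outVert a t ∧ (t = 0 ∨ t = E.lastIndex a) := by
      intro k hk z hkz
      refine (hb k hk z hkz).imp id fun hz => ?_
      have hzS := Or.inr (a := z ∈ ({u, a.fst, a.snd} : Set V))
        (mem_attachments_closedStar.2 ⟨hz, k, hk, hkz⟩)
      obtain ⟨t, hit, htj, rfl⟩ := (hmem z).1 hz
      refine ⟨t, hit, htj, rfl, ?_⟩
      by_contra ht
      exact hfree t (by omega) (by omega) hzS
    -- In a block the bridge needs two attachments, so the enclosing arc extends over all indices.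
    obtain rfl : i = 0 := by
      by_contra hi
      refine hB.not_boundedBy_singleton (y := E.outVert a j) (w := E.outVert a i)
        (fun k hk z hkz => ?_) (hnot j hij.le le_rfl) hvK (hnot i le_rfl hij.le)
        fun h => hij.ne (hinj (by omega) hj h)
      refine (hattach k hk z hkz).imp id ?_
      rintro ⟨t, hit, htj, rfl, ht⟩
      obtain rfl : t = j := by omega
      rfl
    obtain rfl : j = E.lastIndex a := by
      by_contra hjm
      refine hB.not_boundedBy_singleton (y := E.outVert a 0) (w := E.outVert a j)
        (fun k hk z hkz => ?_) (hnot 0 le_rfl hij.le) hvK (hnot j hij.le le_rfl)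
        fun h => hij.ne' (hinj (by omega) (by omega) h)
      refine (hattach k hk z hkz).imp id ?_
      rintro ⟨t, hit, htj, rfl, ht⟩
      obtain rfl : t = 0 := by omega
      rfl
    -- The ends of `α` separate `v` from the vertex with index 1, which is on the enclosing arc.
    refine isTwoSeparator_of_boundedBy hne (fun k hk z hkz => ?_) hvK (hnot 0 le_rfl hij.le)
      (hnot _ hij.le le_rfl) (hnot 1 (by omega) (by omega))
      (fun h => ?_) (fun h => ?_)
    · refine (hattach k hk z hkz).imp id ?_
      rintro ⟨t, hit, htj, rfl, rfl | rfl⟩ <;> simp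
    · have := hinj (by omega) (by omega) h; omega
    · have := hinj (by omega) (by omega) h; omega
  -- As `v` is in `A`, one of the two given separators encloses it.
  · exfalso
    rcases hvA with h | h
    · exact hno (E.exists_encloses hB ha huS (by omega) (by omega) hsep h)
    · exact hno (E.exists_encloses hB ha huS (by omega) (by omega) hsep' h)

end BoundaryPoints

/-! ### Components with at most two attachments that meet `C`. -/

section Bridges

/-- A component of `B - T` that meets `C` and has at most two attachments meets `C` exactly in the
interior of `cCd`, where `c` and `d` are the attachments. -/
theorem exists_interval_of_encard_le [Finite V] (hB : IsBlock B) (ha : E.IsOuterDart a)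
    {T : Set V} (hT : ∀ x y, ∃ w ∈ T, w ≠ x ∧ w ≠ y) (h0 : E.outVert a 0 ∈ T)
    (hm : E.outVert a (E.lastIndex a) ∈ T) {x : V}
    (hN : {z | z ∈ T ∧ ∃ k ∈ offComponent B T x, B.Adj k z}.encard ≤ 2)
    {t : ℕ} (ht : t ≤ E.lastIndex a) (htK : E.outVert a t ∈ offComponent B T x) :
    ∃ i j, i < t ∧ t < j ∧ j ≤ E.lastIndex a ∧ E.outVert a i ∈ T ∧ E.outVert a j ∈ T ∧
      BoundedBy B (offComponent B T x) {E.outVert a i, E.outVert a j} ∧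
      (∀ s ≤ E.lastIndex a, E.outVert a s ∈ offComponent B T x ↔ i < s ∧ s < j) ∧
      IsTwoSeparator B (E.outVert a i) (E.outVert a j) := by
  set K := offComponent B T x with hK
  have hKT : ∀ {z}, z ∈ K → z ∉ T := notMem_of_mem_offComponent
  have hb : BoundedBy B K T := boundedBy_offComponent T x
  have hleft : ∀ t, E.outVert a t ∈ K → ∃ i < t, E.outVert a i ∉ K ∧
      ∀ s, i < s → s ≤ t → E.outVert a s ∈ K := by
    intro t
    induction t with
    | zero => exact fun h => absurd h0 (hKT h)
    | succ t ih =>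
      intro h
      by_cases htK : E.outVert a t ∈ K
      · obtain ⟨i, hi, hiK, hs⟩ := ih htK
        refine ⟨i, by omega, hiK, fun s his hst => ?_⟩
        rcases hst.lt_or_eq with hst | rfl
        · exact hs s his (by omega)
        · exact h
      · refine ⟨t, by omega, htK, fun s hts hst => ?_⟩
        obtain rfl : s = t + 1 := by omega
        exact h
  -- Around `t`, take the maximal run of outer vertices in `K`. Since both ends of `α` are in `T`,
  -- it does not wrap around; the vertices next to it on both sides are attachments.
  have hint : ∀ t ≤ E.lastIndex a, E.outVert a t ∈ K → ∃ i j, i < t ∧ t < j ∧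
      j ≤ E.lastIndex a ∧ (∀ s, i < s → s < j → E.outVert a s ∈ K) ∧
      (E.outVert a i ∈ T ∧ ∃ k ∈ K, B.Adj k (E.outVert a i)) ∧
      (E.outVert a j ∈ T ∧ ∃ k ∈ K, B.Adj k (E.outVert a j)) := by
    classical
    intro t ht htK
    obtain ⟨i, hit, hiK, hi⟩ := hleft t htK
    have hex : ∃ d, E.outVert a (t + d) ∉ K :=
      ⟨E.lastIndex a - t, fun h => hKT h (by rwa [Nat.add_sub_cancel' ht])⟩
    have hmin := fun d (hd : d < Nat.find hex) => not_not.1 (Nat.find_min hex hd)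
    have hspec := Nat.find_spec hex
    have hle : Nat.find hex ≤ E.lastIndex a - t :=
      Nat.find_min' hex fun h => hKT h (by rwa [Nat.add_sub_cancel' ht])
    set d := Nat.find hex
    have hd0 : d ≠ 0 := by intro h; rw [h] at hspec; exact hspec htK
    have hall : ∀ s, i < s → s < t + d → E.outVert a s ∈ K := by
      intro s his hsd
      rcases le_or_gt s t with h | h
      · exact hi s his h
      · have := hmin (s - t) (by omega)
        rwa [Nat.add_sub_cancel' h.le] at this
    obtain ⟨d', hd'⟩ := Nat.exists_eq_succ_of_ne_zero hd0
    have hadj₁ := (E.adj_outVert a i).symm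
    have hadj₂ := E.adj_outVert a (t + d')
    have hK₁ := hall (i + 1) (by omega) (by omega)
    have hK₂ := hall (t + d') (by omega) (by omega)
    rw [show t + d' + 1 = t + d by omega] at hadj₂
    exact ⟨i, t + d, hit, by omega, by omega, hall,
      ⟨(hb _ hK₁ _ hadj₁).resolve_left hiK, _, hK₁, hadj₁⟩,
      ⟨(hb _ hK₂ _ hadj₂).resolve_left hspec, _, hK₂, hadj₂⟩⟩
  obtain ⟨i, j, hit, htj, hj, hall, hiN, hjN⟩ := hint t ht htK
  have hne : E.outVert a i ≠ E.outVert a j := fun h => by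
    have := E.outVert_inj hB ha (by omega) hj h; omega
  have hNeq : ({E.outVert a i, E.outVert a j} : Set V) =
      {z | z ∈ T ∧ ∃ k ∈ K, B.Adj k z} := by
    refine Set.Finite.eq_of_subset_of_encard_le (Set.toFinite _) ?_ ?_
    · rintro z (rfl | rfl)
      exacts [hiN, hjN]
    · rw [Set.encard_pair hne]; exact hN
  have hbK : BoundedBy B K {E.outVert a i, E.outVert a j} := by
    intro k hk z hkz
    rw [hNeq]
    exact (hb k hk z hkz).imp id fun h => ⟨h, k, hk, hkz⟩
  obtain ⟨w, hwT, hwi, hwj⟩ := hT (E.outVert a i) (E.outVert a j)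
  refine ⟨i, j, hit, htj, hj, hiN.1, hjN.1, hbK, fun s hs => ⟨fun hsK => ?_, fun h =>
    hall s h.1 h.2⟩, isTwoSeparator_of_boundedBy hne hbK htK (fun h => hKT h hiN.1)
    (fun h => hKT h hjN.1) (fun h => hKT h hwT) hwi hwj⟩
  -- Another run would give the same two attachments as its ends, so it is the same run.
  obtain ⟨i', j', his, hsj, hj', _, hi'N, hj'N⟩ := hint s hs hsK
  have hmem : ∀ r ≤ E.lastIndex a, E.outVert a r ∈ {z | z ∈ T ∧ ∃ k ∈ K, B.Adj k z} →
      r = i ∨ r = j := by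
    intro r hr h
    rw [← hNeq] at h
    exact h.imp (E.outVert_inj hB ha hr (by omega)) (E.outVert_inj hB ha hr (by omega))
  have h1 := hmem i' (by omega) hi'N
  have h2 := hmem j' (by omega) hj'N
  omega

/-- There is no boundary point in such an interval. -/
theorem IsBoundaryPoints.outVert_notMem_of_boundedBy [Finite V] (hB : IsBlock B)
    (ha : E.IsOuterDart a) {u v : V} {S : Set V} (hS : E.IsBoundaryPoints u a v S)
    {K : Set V} (huK : u ∉ K) (hvK : v ∉ K) (hfst : a.fst ∉ K) (hsnd : a.snd ∉ K)
    {i j : ℕ} (hi : i ≤ E.lastIndex a) (hj : j ≤ E.lastIndex a)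
    (hK : BoundedBy B K {E.outVert a i, E.outVert a j}) {s : ℕ}
    (hsK : E.outVert a s ∈ K) : E.outVert a s ∉ S := by
  intro hsS
  have hthree : E.outVert a s ∉ ({u, a.fst, a.snd} : Set V) := by
    rintro (h | h | h)
    exacts [huK (h ▸ hsK), hfst (h ▸ hsK), hsnd (h ▸ hsK)]
  rcases hS with ⟨_, rfl⟩ | ⟨hv, ⟨x, y, W, J, hW, hJ, hvJ, rfl⟩ | ⟨_, rfl⟩⟩
  · rcases hsS with h | h | h | h
    exacts [huK (h ▸ hsK), hfst (h ▸ hsK), hsnd (h ▸ hsK), hvK (h ▸ hsK)]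
  · obtain ⟨w, w', hww, hw', hsep, hvi, hmem, hvW, rfl⟩ := hW.exists_bridge hB ha hv hJ hvJ
    -- The remaining possibility is an attachment of the bridge around `v`. The component of `v`
    -- contains no outer vertex, so it cannot pass the ends of the interval; having a vertex next to
    -- the attachment, it would lie in `K` together with `v`.
    obtain ⟨_, k, hk, hks⟩ := mem_attachments_closedStar.1 (hsS.resolve_left hthree)
    have hin : ∀ z ∈ offComponent B W.toSubgraph.verts v, z ∈ E.inside a w w' := by
      rintro z ⟨p, hp⟩
      refine E.boundedBy_inside.mem_of_walk p hvi fun z hz h => hp z hz ((hmem z).2 ?_)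
      rcases h with rfl | rfl
      · exact ⟨w, le_rfl, hww.le, rfl⟩
      · exact ⟨w', hww.le, le_rfl, rfl⟩
    have hno : ∀ e ≤ E.lastIndex a,
        E.outVert a e ∉ offComponent B W.toSubgraph.verts v := by
      intro e he h
      have h1 : ¬ (w ≤ e ∧ e ≤ w') := fun h' =>
        notMem_of_mem_offComponent h ((hmem _).2 ⟨e, h'.1, h'.2, rfl⟩)
      exact E.outVert_notMem_inside hB ha hw' hsep he (by omega) (hin _ h)
    have hkK : k ∈ K := by
      rcases hK _ hsK k hks.symm with h | rfl | rfl
      · exact h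
      · exact absurd hk (hno i hi)
      · exact absurd hk (hno j hj)
    obtain ⟨p, hp⟩ := mem_offComponent_symm hk
    refine hvK (hK.mem_of_walk p hkK fun z hz h => ?_)
    have hz' := mem_offComponent_trans hk (support_subset_offComponent p hp z hz)
    rcases h with rfl | rfl
    exacts [hno i hi hz', hno j hj hz']
  · exact hthree hsS

end Bridges
end PlaneEmbedding

/-- Such a path has at least two edges, hence three vertices. This is how `P ≠ α` enters, both for
the length of `C` and for finding a vertex beyond a separator. -/
theorem exists_third_vertex {V : Type*} {B : SimpleGraph V} {u v : V} {P : B.Walk u v}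
    (hP : P.IsPath) {e : Sym2 V} (he : e ∈ P.edges) (hne : P.edges ≠ [e]) (x y : V) :
    ∃ w ∈ P.support, w ≠ x ∧ w ≠ y := by
  by_contra! h
  have hsub : P.support ⊆ [x, y] := by
    intro w hw
    by_cases hwx : w = x
    · simp [hwx]
    · simp [h w hw hwx]
  have hlen := (hP.support_nodup.subperm hsub).length_le
  rw [Walk.length_support, ← Walk.length_edges] at hlen
  obtain ⟨e', he'⟩ : ∃ e', P.edges = [e'] := by
    rw [← List.length_eq_one_iff]
    have := List.length_pos_of_mem he
    simp only [List.length_cons, List.length_nil] at hlen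
    omega
  rw [he', List.mem_singleton] at he
  exact hne (he ▸ he')

/-- A path that uses the edge between its endvertices consists of this edge. -/
theorem edges_eq_of_mem {V : Type*} {B : SimpleGraph V} {u v : V} {P : B.Walk u v}
    (hP : P.IsPath) (h : s(u, v) ∈ P.edges) : P.edges = [s(u, v)] := by
  cases P with
  | nil => simp at h
  | @cons _ z _ hadj P =>
    rw [Walk.cons_isPath_iff] at hP
    rw [Walk.edges_cons, List.mem_cons] at h
    rcases h with h | h
    · obtain rfl : v = z := by
        rcases Sym2.eq_iff.1 h with ⟨_, h⟩ | ⟨h, _⟩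
        · exact h
        · exact absurd h hadj.ne
      rw [(Walk.isPath_iff_nil.1 hP.1).eq_nil]
      simp
    · exact absurd (P.fst_mem_support_of_mem_edges h) hP.2

/-! ### Boundary parts and maximal separators in terms of indices. -/

namespace PlaneEmbedding

variable {V : Type*} {B : SimpleGraph V} (E : PlaneEmbedding B) {a : B.Dart}

/-- If `C` had only two darts, `a.snd` would have degree one and `a.fst` would separate it from a
third vertex. -/
theorem two_le_lastIndex [Finite V] (hB : IsBlock B) (h3 : ∃ w, w ≠ a.fst ∧ w ≠ a.snd) :
    2 ≤ E.lastIndex a := by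
  by_contra hlt
  have hpos := E.lastIndex_pos (a := a)
  have h1 : E.lastIndex a = 1 := by omega
  have h2 : E.outDart a 0 = a.symm := by
    refine Dart.ext _ _ (Prod.ext (E.outVert_zero a) ?_)
    have := E.outDart_snd a 0
    rw [zero_add, ← h1, outVert_lastIndex] at this
    exact this
  have h4 : E.rot a.symm = a.symm := h2
  obtain ⟨w, hw₁, hw₂⟩ := h3
  refine hB.not_boundedBy_singleton (A := {a.snd}) (y := a.fst) (fun k hk x hkx => ?_)
    a.fst_ne_snd rfl hw₂ hw₁
  rw [Set.mem_singleton_iff] at hk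
  subst hk
  have : Finite B.Dart := Finite.of_injective _ (Dart.toProd_injective)
  obtain ⟨n, hn⟩ := (E.rot_sameCycle a.symm ⟨(_, _), hkx⟩ rfl).exists_nat_pow_eq
  rw [Equiv.Perm.pow_apply_eq_self_of_apply_eq_self h4] at hn
  exact Or.inr (congrArg (fun d : B.Dart => d.snd) hn).symm

theorem not_isOuterDart_symm [Finite V] (hB : IsBlock B) (ha : E.IsOuterDart a)
    (hm : 2 ≤ E.lastIndex a) : ¬ E.IsOuterDart a.symm := by
  intro h
  obtain ⟨t, ht, hta⟩ := E.exists_outDart_eq ha h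
  rcases ht.lt_or_eq with ht | rfl
  · exact E.edge_outDart_ne hB ha hm ht (by rw [hta, Dart.edge_symm])
  · rw [outDart_lastIndex] at hta
    exact a.symm_ne hta.symm

/-- Inclusion of arcs, in terms of indices. -/
theorem RunsFrom.le_of_verts_subset [Finite V] {E : PlaneEmbedding B} (hB : IsBlock B)
    (ha : E.IsOuterDart a) {i L i' L' : ℕ} {x y x' y' : V} {W : B.Walk x y} {W' : B.Walk x' y'}
    (hW : E.RunsFrom a i L W) (hx : x = E.outVert a i) (hi : i + L ≤ E.lastIndex a)
    (hW' : E.RunsFrom a i' L' W') (hx' : x' = E.outVert a i') (hi' : i' + L' ≤ E.lastIndex a)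
    (h : W.toSubgraph.verts ⊆ W'.toSubgraph.verts) : i' ≤ i ∧ i + L ≤ i' + L' := by
  have key : ∀ t ≤ L, ∃ t' ≤ L', i + t = i' + t' := by
    intro t ht
    obtain ⟨t', ht', h'⟩ := (hW'.mem_support hx').1 (W'.mem_verts_toSubgraph.1
      (h (W.mem_verts_toSubgraph.2 ((hW.mem_support hx).2 ⟨t, ht, rfl⟩))))
    exact ⟨t', ht', E.outVert_inj hB ha (by omega) (by omega) h'⟩
  obtain ⟨t, ht, h1⟩ := key 0 (Nat.zero_le _)
  obtain ⟨t', ht', h2⟩ := key L le_rfl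
  omega

theorem RunsFrom.toSubgraph_lt [Finite V] {E : PlaneEmbedding B} (hB : IsBlock B)
    (ha : E.IsOuterDart a) {i L i' L' : ℕ} {x y x' y' : V} {W : B.Walk x y} {W' : B.Walk x' y'}
    (hW : E.RunsFrom a i L W) (hx : x = E.outVert a i)
    (hW' : E.RunsFrom a i' L' W') (hx' : x' = E.outVert a i') (hi' : i' + L' ≤ E.lastIndex a)
    (h₁ : i' ≤ i) (h₂ : i + L ≤ i' + L') (h₃ : L < L') : W.toSubgraph < W'.toSubgraph := by
  refine lt_of_le_not_ge (hW.toSubgraph_le hx hW' hx' h₁ h₂) fun h => ?_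
  have := hW'.le_of_verts_subset hB ha hx' hi' hW hx (by omega) h.1
  omega

theorem RunsFrom.isFreeArc_iff [Finite V] {E : PlaneEmbedding B} (hB : IsBlock B)
    (ha : E.IsOuterDart a) {S : Set V} {i L : ℕ} {x y : V} {W : B.Walk x y}
    (hW : E.RunsFrom a i L W) (hx : x = E.outVert a i) (hy : y = E.outVert a (i + L))
    (hi : i + L ≤ E.lastIndex a) :
    E.IsFreeArc S W ↔ ∀ t, i < t → t < i + L → E.outVert a t ∉ S := by
  constructor
  · rintro ⟨_, h⟩ t hit hti
    refine h _ ((hW.mem_support hx).2 ⟨t - i, by omega, by congr 1; omega⟩) (fun h => ?_)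
      (fun h => ?_)
    · have := E.outVert_inj hB ha (by omega) (by omega) (h.trans hx); omega
    · have := E.outVert_inj hB ha (by omega) (by omega) (h.trans hy); omega
  · refine fun h => ⟨hW.isArc hB ha hx hi, fun z hz hzx hzy => ?_⟩
    obtain ⟨t, ht, rfl⟩ := (hW.mem_support hx).1 hz
    refine h _ ?_ ?_
    · have : t ≠ 0 := by rintro rfl; exact hzx hx.symm
      omega
    · have : t ≠ L := by rintro rfl; exact hzy hy.symm
      omega

theorem notMem_darts_of_toSubgraph_le [Finite V] (hB : IsBlock B) (ha : E.IsOuterDart a)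
    (hm : 2 ≤ E.lastIndex a) {i L : ℕ} {x y x' y' : V} {W : B.Walk x y} {Z : B.Walk x' y'}
    (hZ : E.RunsFrom a i L Z) (hi : i + L ≤ E.lastIndex a)
    (h : W.toSubgraph ≤ Z.toSubgraph) : a ∉ W.darts := by
  intro haW
  obtain ⟨d, hd, hde⟩ := List.mem_map.1 (mem_edges_of_mem_darts_of_le h haW)
  obtain ⟨t, ht, rfl⟩ := hZ.mem_darts.1 hd
  exact E.edge_outDart_ne hB ha hm (by omega) hde

theorem IsArc.onOuter_of_ne {E : PlaneEmbedding B} {x y : V} {W : B.Walk x y} (hW : E.IsArc W)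
    (hne : x ≠ y) : E.OnOuter x := by
  cases W with
  | nil => exact absurd rfl hne
  | cons hadj W => exact ⟨⟨(_, _), hadj⟩, hW.2 _ (by simp), rfl⟩

/-- A free arc that contains the dart `a` consists of it. -/
theorem IsFreeArc.eq_of_mem_darts [Finite V] {E : PlaneEmbedding B} (hB : IsBlock B)
    (ha : E.IsOuterDart a) {S : Set V} (hfst : a.fst ∈ S) (hsnd : a.snd ∈ S) {p q : V}
    {Z : B.Walk p q} (hZ : E.IsFreeArc S Z) (haZ : a ∈ Z.darts) :
    p = a.fst ∧ q = a.snd ∧ Z.darts = [a] ∧ Z.support = [p, q] := by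
  have hpq : p ≠ q := by
    rintro rfl
    rw [(Walk.isPath_iff_nil.1 hZ.1.1).eq_nil] at haZ
    simp at haZ
  obtain ⟨i, hi, hpi⟩ := (E.onOuter_iff ha).1 (hZ.1.onOuter_of_ne hpq)
  obtain ⟨hrun, hq, _⟩ := IsArc.runsFrom E hB ha hZ.1 hpi
  have hs := hZ.1.1.support_nodup
  have hsupp := hrun.support_eq hpi
  rw [hsupp, List.nodup_map_iff_inj_on List.nodup_range] at hs
  obtain ⟨t, ht, hat⟩ := hrun.mem_darts.1 haZ
  -- Boundary points on `Z` are ends of `Z`. Applied to the consecutive ends of `α`, this forces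
  -- length one.
  have key : ∀ r ≤ Z.length, E.outVert a (i + r) ∈ S → r = 0 ∨ r = Z.length := by
    intro r hr hrS
    by_contra! hcon
    refine hZ.2 _ ((hrun.mem_support hpi).2 ⟨r, hr, rfl⟩) (fun h => ?_) (fun h => ?_) hrS
    · exact hcon.1 (hs r (by rw [List.mem_range]; omega) 0 (by simp) (h.trans hpi))
    · exact hcon.2 (hs r (by rw [List.mem_range]; omega) _ (by simp) (h.trans hq))
  have hf : a.fst = E.outVert a (i + t) := congrArg (fun d : B.Dart => d.fst) hat
  have hsn : a.snd = E.outVert a (i + (t + 1)) :=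
    (congrArg (fun d : B.Dart => d.snd) hat).trans (E.outDart_snd a _)
  have h1 := key t ht.le (hf ▸ hfst)
  have h2 := key (t + 1) ht (hsn ▸ hsnd)
  obtain rfl : t = 0 := by omega
  have hL : Z.length = 1 := by omega
  refine ⟨hpi.trans hf.symm, by rw [hq, hL, hsn], ?_, ?_⟩
  · rw [hrun, hL]; simpa using hat.symm
  · rw [hsupp, hL]
    simp [hpi, hq, hL, List.range_succ]

/-- A separator in a boundary part: it is `α`, or given by indices. -/
theorem IsBoundaryPart.exists_indices [Finite V] {E : PlaneEmbedding B} (hB : IsBlock B)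
    (ha : E.IsOuterDart a) (hm : 2 ≤ E.lastIndex a) {S : Set V} (hfst : a.fst ∈ S)
    (hsnd : a.snd ∈ S) {p q : V} {Z : B.Walk p q} (hZ : E.IsBoundaryPart S Z) {c d : V}
    {W : B.Walk c d} (hW : E.IsArc W) (hcd : c ≠ d) (hWZ : W.toSubgraph ≤ Z.toSubgraph) :
    (c = a.fst ∧ d = a.snd) ∨ ∃ z L i M, z ≤ i ∧ 0 < M ∧ i + M ≤ z + L ∧ z + L ≤ E.lastIndex a ∧
      p = E.outVert a z ∧ E.RunsFrom a z L Z ∧ c = E.outVert a i ∧ d = E.outVert a (i + M) ∧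
      E.RunsFrom a i M W ∧ (∀ t, z < t → t < z + L → E.outVert a t ∉ S) ∧
      E.outVert a z ∈ S ∧ E.outVert a (z + L) ∈ S := by
  have hc := hW.onOuter_of_ne hcd
  by_cases haZ : a ∈ Z.darts
  · left
    obtain ⟨hp, hq, hdarts, hsupp⟩ := hZ.1.eq_of_mem_darts hB ha hfst hsnd haZ
    have hca : c = a.fst := by
      cases W with
      | nil => exact absurd rfl hcd
      | @cons _ z _ hadj W =>
        have h1 := mem_edges_of_mem_darts_of_le hWZ (d := ⟨(c, z), hadj⟩) (by simp)
        rw [Walk.edges, hdarts, List.map_singleton, List.mem_singleton, dart_edge_eq_iff] at h1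
        rcases h1 with h1 | h1
        · rw [← h1]
        · exact absurd (h1 ▸ hW.2 _ (by simp)) (E.not_isOuterDart_symm hB ha hm)
    have hd : d ∈ Z.support :=
      Z.mem_verts_toSubgraph.1 (hWZ.1 (W.mem_verts_toSubgraph.2 W.end_mem_support))
    rw [hsupp, List.mem_pair] at hd
    refine ⟨hca, ?_⟩
    rcases hd with h | h
    · exact absurd (hca.trans (hp.symm.trans h.symm)) hcd
    · exact h.trans hq
  · right
    have hpq : p ≠ q := by
      rintro rfl
      have h1 : Z.support = [p] := by rw [(Walk.isPath_iff_nil.1 hZ.1.1.1).eq_nil]; rfl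
      have h2 : ∀ w ∈ W.support, w = p := fun w hw => by
        simpa [h1] using Z.mem_verts_toSubgraph.1 (hWZ.1 (W.mem_verts_toSubgraph.2 hw))
      exact hcd ((h2 _ W.start_mem_support).trans (h2 _ W.end_mem_support).symm)
    obtain ⟨z, hzL, hp, hq, hrunZ⟩ :=
      IsArc.exists_interval E hB ha hZ.1.1 (hZ.1.1.onOuter_of_ne hpq) haZ
    obtain ⟨i, hiM, hci, hdi, hrunW⟩ := IsArc.exists_interval E hB ha hW hc
      (E.notMem_darts_of_toSubgraph_le hB ha hm hrunZ hzL hWZ)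
    obtain ⟨h1, h2⟩ := hrunW.le_of_verts_subset hB ha hci hiM hrunZ hp hzL hWZ.1
    have hM : 0 < W.length := by
      rw [Nat.pos_iff_ne_zero]
      exact fun h => hcd (Walk.eq_of_length_eq_zero h)
    have hfree := (hrunZ.isFreeArc_iff hB ha hp hq hzL).1 hZ.1
    refine ⟨z, Z.length, i, W.length, h1, hM, h2, hzL, hp, hrunZ, hci, hdi, hrunW, hfree, ?_, ?_⟩
    -- If an end of `Z` were not a boundary point, `Z` could be prolonged by one edge. This stays
    -- within the indices, because the extreme ones belong to the ends of `α`.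
    · by_contra hzS
      have hz0 : z ≠ 0 := by rintro rfl; exact hzS (E.outVert_zero a ▸ hsnd)
      obtain ⟨Z', hZ'⟩ := E.exists_runsFrom (a := a) (z - 1) (Z.length + 1)
      have hfree' : E.IsFreeArc S Z' := by
        refine (hZ'.isFreeArc_iff hB ha rfl rfl (by omega)).2 fun t ht ht' => ?_
        rcases eq_or_ne t z with rfl | htz
        · exact hzS
        · exact hfree t (by omega) (by omega)
      have h := hZ.2 _ _ Z' hfree' (hrunZ.toSubgraph_le hp hZ' rfl (by omega) (by omega))
      have := hZ'.le_of_verts_subset hB ha rfl (by omega) hrunZ hp hzL h.1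
      omega
    · by_contra hzS
      have hz0 : z + Z.length ≠ E.lastIndex a := by
        intro h; rw [h, outVert_lastIndex] at hzS; exact hzS hfst
      obtain ⟨Z', hZ'⟩ := E.exists_runsFrom (a := a) z (Z.length + 1)
      have hfree' : E.IsFreeArc S Z' := by
        refine (hZ'.isFreeArc_iff hB ha rfl rfl (by omega)).2 fun t ht ht' => ?_
        rcases eq_or_ne t (z + Z.length) with rfl | htz
        · exact hzS
        · exact hfree t (by omega) (by omega)
      have h := hZ.2 _ _ Z' hfree' (hrunZ.toSubgraph_le hp hZ' rfl (by omega) (by omega))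
      have := hZ'.le_of_verts_subset hB ha rfl (by omega) hrunZ hp hzL h.1
      omega

/-- Maximal separators in terms of indices. -/
theorem IsMaximalSeparator.exists_indices [Finite V] {E : PlaneEmbedding B} (hB : IsBlock B)
    (ha : E.IsOuterDart a) (hm : 2 ≤ E.lastIndex a) {S : Set V} (hfst : a.fst ∈ S)
    (hsnd : a.snd ∈ S) {c d : V} (h : E.IsMaximalSeparator S c d) :
    (c = a.fst ∧ d = a.snd) ∨ ∃ z i j z', z ≤ i ∧ i < j ∧ j ≤ z' ∧ z' ≤ E.lastIndex a ∧
      c = E.outVert a i ∧ d = E.outVert a j ∧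
      IsTwoSeparator B (E.outVert a i) (E.outVert a j) ∧
      (∀ t, z < t → t < z' → E.outVert a t ∉ S) ∧ E.outVert a z ∈ S ∧ E.outVert a z' ∈ S ∧
      ∀ i' j', z ≤ i' → i' ≤ i → j ≤ j' → j' ≤ z' →
        IsTwoSeparator B (E.outVert a i') (E.outVert a j') → i' = i ∧ j' = j := by
  obtain ⟨p, q, Z, W, hZ, ⟨hsep, hW, hWZ⟩, hmax⟩ := h
  refine (hZ.exists_indices hB ha hm hfst hsnd hW hsep.1 hWZ).imp id ?_
  rintro ⟨z, L, i, M, hzi, hM, hiM, hzL, hp, hrunZ, rfl, rfl, hrunW, hfree, hzS, hzS'⟩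
  refine ⟨z, i, i + M, z + L, hzi, by omega, hiM, hzL, rfl, rfl, hsep, hfree, hzS, hzS', ?_⟩
  intro i' j' h1 h2 h3 h4 hsep'
  obtain ⟨M', rfl⟩ : ∃ M', j' = i' + M' := ⟨j' - i', by omega⟩
  by_contra hne
  obtain ⟨W', hW'⟩ := E.exists_runsFrom (a := a) i' M'
  exact hmax _ _ W' ⟨hsep', hW'.isArc hB ha rfl (by omega),
    hW'.toSubgraph_le rfl hrunZ hp h1 h4⟩
    (hrunW.toSubgraph_lt hB ha rfl hW' rfl (by omega) h2 (by omega) (by omega))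

/-- A free interval lies in a boundary part. -/
theorem exists_isBoundaryPart [Finite V] (hB : IsBlock B) (ha : E.IsOuterDart a)
    (hm : 2 ≤ E.lastIndex a) {S : Set V} (hfst : a.fst ∈ S) (hsnd : a.snd ∈ S) {i j : ℕ}
    (hij : i < j) (hj : j ≤ E.lastIndex a) (hfree : ∀ t, i < t → t < j → E.outVert a t ∉ S) :
    ∃ z L, z ≤ i ∧ j ≤ z + L ∧ z + L ≤ E.lastIndex a ∧
      ∃ Z : B.Walk (E.outVert a z) (E.outVert a (z + L)),
        E.RunsFrom a z L Z ∧ E.IsBoundaryPart S Z := by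
  classical
  have hS0 : E.outVert a 0 ∈ S := by rwa [outVert_zero]
  have hSm : E.outVert a (E.lastIndex a) ∈ S := by rwa [outVert_lastIndex]
  -- The part extends from the last boundary point up to `i` to the first one from `j` on.
  obtain ⟨z, hzi, hzS, hz⟩ : ∃ z ≤ i, E.outVert a z ∈ S ∧
      ∀ t, z < t → t ≤ i → E.outVert a t ∉ S :=
    ⟨Nat.findGreatest (fun t => E.outVert a t ∈ S) i, Nat.findGreatest_le _,
      Nat.findGreatest_spec (P := fun t => E.outVert a t ∈ S) (Nat.zero_le i) hS0,
      fun t h1 h2 => Nat.findGreatest_is_greatest h1 h2⟩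
  have hex : ∃ d, E.outVert a (j + d) ∈ S :=
    ⟨E.lastIndex a - j, by rwa [Nat.add_sub_cancel' hj]⟩
  obtain ⟨z', hjz', hz'm, hzS', hz'⟩ : ∃ z', j ≤ z' ∧ z' ≤ E.lastIndex a ∧ E.outVert a z' ∈ S ∧
      ∀ t, j ≤ t → t < z' → E.outVert a t ∉ S := by
    refine ⟨j + Nat.find hex, by omega, ?_, Nat.find_spec hex, fun t h1 h2 h3 => ?_⟩
    · have := Nat.find_min' hex (m := E.lastIndex a - j) (by rwa [Nat.add_sub_cancel' hj])
      omega
    · exact Nat.find_min hex (m := t - j) (by omega) (by rwa [Nat.add_sub_cancel' h1])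
  obtain ⟨L, rfl⟩ : ∃ L, z' = z + L := ⟨z' - z, by omega⟩
  obtain ⟨Z, hZ⟩ := E.exists_runsFrom (a := a) z L
  have hZfree : E.IsFreeArc S Z := by
    refine (hZ.isFreeArc_iff hB ha rfl rfl hz'm).2 fun t ht ht' => ?_
    rcases le_or_gt t i with h | h
    · exact hz t ht h
    rcases lt_or_ge t j with h' | h'
    · exact hfree t h h'
    · exact hz' t h' ht'
  refine ⟨z, L, hzi, hjz', hz'm, Z, hZ, hZfree, fun p q Z' hZ' hle => ?_⟩
  by_cases haZ : a ∈ Z'.darts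
  · exfalso
    obtain ⟨hp, hq, hdarts, _⟩ := hZ'.eq_of_mem_darts hB ha hfst hsnd haZ
    have h1 := mem_edges_of_mem_darts_of_le hle (hZ.mem_darts.2 ⟨0, by omega, rfl⟩)
    rw [Walk.edges, hdarts, List.map_singleton, List.mem_singleton] at h1
    exact E.edge_outDart_ne hB ha hm (by omega) h1
  · have hpq : p ≠ q := by
      rintro rfl
      have h1 := mem_edges_of_mem_darts_of_le hle (hZ.mem_darts.2 ⟨0, by omega, rfl⟩)
      rw [(Walk.isPath_iff_nil.1 hZ'.1.1).eq_nil] at h1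
      simp at h1
    obtain ⟨w, hw, hp, hq, hrun⟩ :=
      IsArc.exists_interval E hB ha hZ'.1 (hZ'.1.onOuter_of_ne hpq) haZ
    have hfree' := (hrun.isFreeArc_iff hB ha hp hq hw).1 hZ'
    obtain ⟨h1, h2⟩ := hZ.le_of_verts_subset hB ha rfl hz'm hrun hp hw hle.1
    have h3 : z ≤ w := by
      by_contra h
      exact hfree' z (by omega) (by omega) hzS
    have h4 : w + Z'.length ≤ z + L := by
      by_contra h
      exact hfree' (z + L) (by omega) (by omega) hzS'
    exact hrun.toSubgraph_le hp hZ rfl h3 h4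

/-- A 2-separator without boundary points inside is contained in a maximal one. -/
theorem exists_isMaximalSeparator [Finite V] (hB : IsBlock B) (ha : E.IsOuterDart a)
    (hm : 2 ≤ E.lastIndex a) {S : Set V} (hfst : a.fst ∈ S) (hsnd : a.snd ∈ S) {i j : ℕ}
    (hij : i < j) (hj : j ≤ E.lastIndex a) (hfree : ∀ t, i < t → t < j → E.outVert a t ∉ S)
    (hsep : IsTwoSeparator B (E.outVert a i) (E.outVert a j)) :
    ∃ p q, p ≤ i ∧ j ≤ q ∧ q ≤ E.lastIndex a ∧
      E.IsMaximalSeparator S (E.outVert a p) (E.outVert a q) := by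
  classical
  obtain ⟨z, L, hzi, hjz, hzL, Z, hZ, hZb⟩ := E.exists_isBoundaryPart hB ha hm hfst hsnd hij hj hfree
  let F := (Finset.range (z + L + 1) ×ˢ Finset.range (z + L + 1)).filter fun x =>
    z ≤ x.1 ∧ x.1 ≤ i ∧ j ≤ x.2 ∧ IsTwoSeparator B (E.outVert a x.1) (E.outVert a x.2)
  have hF : ∀ x, x ∈ F ↔ x.2 ≤ z + L ∧ z ≤ x.1 ∧ x.1 ≤ i ∧ j ≤ x.2 ∧
      IsTwoSeparator B (E.outVert a x.1) (E.outVert a x.2) := by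
    intro x
    simp only [F, Finset.mem_filter, Finset.mem_product, Finset.mem_range]
    constructor
    · rintro ⟨⟨_, h⟩, h'⟩; exact ⟨by omega, h'⟩
    · rintro ⟨h, h1, h2, h3⟩; exact ⟨⟨by omega, by omega⟩, h1, h2, h3⟩
  -- Among the separators around the given one in this part, a widest interval is inclusion-maximal.
  obtain ⟨⟨p, q⟩, hpq, hmax⟩ := F.exists_max_image (fun x => x.2 - x.1)
    ⟨(i, j), (hF _).2 ⟨hjz, hzi, le_rfl, le_rfl, hsep⟩⟩
  obtain ⟨hq, hzp, hpi, hjq, hsep'⟩ := (hF _).1 hpq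
  dsimp only at hq hzp hpi hjq hsep'
  refine ⟨p, q, hpi, hjq, by omega, ?_⟩
  obtain ⟨M, rfl⟩ : ∃ M, q = p + M := ⟨q - p, by omega⟩
  obtain ⟨W, hW⟩ := E.exists_runsFrom (a := a) p M
  refine ⟨_, _, Z, W, hZb, ⟨hsep', hW.isArc hB ha rfl (by omega),
    hW.toSubgraph_le rfl hZ rfl hzp hq⟩, ?_⟩
  rintro c d W' ⟨hsep'', hW', hWZ⟩ hlt
  obtain ⟨r, hr, hc, hd, hrun⟩ := IsArc.exists_interval E hB ha hW'
    (hW'.onOuter_of_ne hsep''.1) (E.notMem_darts_of_toSubgraph_le hB ha hm hZ hzL hWZ)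
  have h1 := hrun.le_of_verts_subset hB ha hc hr hZ rfl hzL hWZ.1
  have h2 := hW.le_of_verts_subset hB ha rfl (by omega) hrun hc hr hlt.le.1
  have h3 := hmax (r, r + W'.length) ((hF _).2 ⟨h1.2, h1.1, by dsimp only; omega,
    by dsimp only; omega, hc ▸ hd ▸ hsep''⟩)
  dsimp only at h3
  exact hlt.not_ge (hrun.toSubgraph_le hc hW rfl (by omega) (by omega))

/-- The cyclic order of outer vertices, in terms of indices. -/
theorem InClockwiseOrder.indices [Finite V] {E : PlaneEmbedding B} (hB : IsBlock B)
    (ha : E.IsOuterDart a) {i j k l : ℕ} (hi : i ≤ E.lastIndex a) (hj : j ≤ E.lastIndex a)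
    (hk : k ≤ E.lastIndex a) (hl : l ≤ E.lastIndex a)
    (h : E.InClockwiseOrder (E.outVert a i) (E.outVert a j) (E.outVert a k) (E.outVert a l))
    (hij : i ≠ j) (hjk : j ≠ k) (hkl : k ≠ l) :
    (i < j ∧ j < k ∧ k < l) ∨ (j < k ∧ k < l ∧ l < i) ∨ (k < l ∧ l < i ∧ i < j) ∨
      (l < i ∧ i < j ∧ j < k) := by
  obtain ⟨W₁, W₂, W₃, hW⟩ := h
  obtain ⟨h1, h2, h3⟩ := IsArc.runsFrom E hB ha hW rfl
  -- The arc may run through `α`, so positions on it determine indices only up to one period. This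
  -- leads to the four rotations of the order.
  have key : ∀ {s t : ℕ}, s ≤ i + E.lastIndex a → t ≤ E.lastIndex a →
      E.outVert a t = E.outVert a s → s = t ∨ s = t + (E.lastIndex a + 1) := by
    intro s t hs ht hst
    rcases le_or_gt s (E.lastIndex a) with h | h
    · exact Or.inl (E.outVert_inj hB ha ht h hst).symm
    · obtain ⟨r, rfl⟩ : ∃ r, s = r + (E.lastIndex a + 1) := ⟨s - (E.lastIndex a + 1), by omega⟩
      rw [outVert_add_period] at hst
      have := E.outVert_inj hB ha ht (by omega) hst
      exact Or.inr (by omega)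
  have hpre₂ : E.IsArc (W₁.append W₂) := by
    refine ⟨hW.1.of_append_left, fun d hd => hW.2 d ?_⟩
    rw [Walk.darts_append]; exact List.mem_append_left _ hd
  have hpre₁ : E.IsArc W₁ := by
    refine ⟨hpre₂.1.of_append_left, fun d hd => hpre₂.2 d ?_⟩
    rw [Walk.darts_append]; exact List.mem_append_left _ hd
  obtain ⟨_, h2', _⟩ := IsArc.runsFrom E hB ha hpre₂ rfl
  obtain ⟨_, h2'', _⟩ := IsArc.runsFrom E hB ha hpre₁ rfl
  simp only [Walk.length_append] at h2 h2' h3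
  have e1 := key (by omega) hj h2''
  have e2 := key (by omega) hk h2'
  have e3 := key (by omega) hl h2
  omega

end PlaneEmbedding
-- The three assertions for Tutte paths.
namespace PlaneEmbedding

variable {V : Type*} {B : SimpleGraph V} {E : PlaneEmbedding B} {a : B.Dart} {u v : V}
  {S : Set V} {P : B.Walk u v}

/-- A component of `B - P` that meets `C` meets it in an interval without boundary points,
whose ends form a 2-separator. -/
theorem IsTuttePath.exists_interval [Finite V] (hB : IsBlock B) (ha : E.IsOuterDart a)
    (hS : E.IsBoundaryPoints u a v S) (hP : E.IsTuttePath P) (haP : a.edge ∈ P.edges)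
    (hPa : P.edges ≠ [a.edge]) {x : V} (hx : x ∉ P.toSubgraph.verts) {t : ℕ}
    (ht : t ≤ E.lastIndex a) (htK : E.outVert a t ∈ offComponent B P.toSubgraph.verts x) :
    ∃ i j, i < t ∧ t < j ∧ j ≤ E.lastIndex a ∧
      (∀ s ≤ E.lastIndex a,
        E.outVert a s ∈ offComponent B P.toSubgraph.verts x ↔ i < s ∧ s < j) ∧
      IsTwoSeparator B (E.outVert a i) (E.outVert a j) ∧
      ∀ s, i < s → s < j → E.outVert a s ∉ S := by
  have hmem : ∀ w, w ∈ P.support → w ∈ P.toSubgraph.verts := fun w =>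
    P.mem_verts_toSubgraph.2
  have hfst : a.fst ∈ P.toSubgraph.verts :=
    hmem _ (P.fst_mem_support_of_mem_edges (haP : s(a.fst, a.snd) ∈ P.edges))
  have hsnd : a.snd ∈ P.toSubgraph.verts :=
    hmem _ (P.snd_mem_support_of_mem_edges (haP : s(a.fst, a.snd) ∈ P.edges))
  have hthird : ∀ y z, ∃ w ∈ P.toSubgraph.verts, w ≠ y ∧ w ≠ z := by
    intro y z
    obtain ⟨w, hw, h⟩ := exists_third_vertex hP.1 haP hPa y z
    exact ⟨w, hmem w hw, h⟩
  have hout : E.IsOuterSubgraph (closedStar B (offComponent B P.toSubgraph.verts x)) :=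
    ⟨E.outDart a t, E.isOuterDart_outDart ha t, (E.outDart a t).adj, Or.inl htK⟩
  have henc := (hP.2 _ (isBridgeOf_closedStar hx)).1 hout
  rw [show attachments P.toSubgraph (closedStar B (offComponent B P.toSubgraph.verts x)) =
    _ from Set.ext fun z => mem_attachments_closedStar] at henc
  obtain ⟨i, j, hit, htj, hj, _, _, hK, hint, hsep⟩ :=
    E.exists_interval_of_encard_le hB ha hthird (by rwa [outVert_zero])
      (by rwa [outVert_lastIndex]) henc ht htK
  have hnot : ∀ z ∈ P.toSubgraph.verts, z ∉ offComponent B P.toSubgraph.verts x :=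
    fun z hz h => notMem_of_mem_offComponent h hz
  refine ⟨i, j, hit, htj, hj, hint, hsep, fun s his hsj => ?_⟩
  exact hS.outVert_notMem_of_boundedBy E hB ha (hnot _ (hmem _ P.start_mem_support))
    (hnot _ (hmem _ P.end_mem_support)) (hnot _ hfst) (hnot _ hsnd) (by omega) hj hK
    ((hint s (by omega)).2 ⟨his, hsj⟩)

theorem not_inClockwiseOrder [Finite V] (hB : IsBlock B) (ha : E.IsOuterDart a)
    (hm : 2 ≤ E.lastIndex a) (hS : E.IsBoundaryPoints u a v S) (hu : E.OnOuter u) (huv : u ≠ v)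
    (hends₁ : ¬ (u = a.fst ∧ v = a.snd)) (hends₂ : ¬ (u = a.snd ∧ v = a.fst))
    {c d c' d' : V} (h : E.IsMaximalSeparator S c d) (h' : E.IsMaximalSeparator S c' d')
    (hdis : Disjoint ({c, d} : Set V) {c', d'}) : ¬ E.InClockwiseOrder c c' d d' := by
  intro hord
  have hfst : a.fst ∈ S := hS.subset (by simp)
  have hsnd : a.snd ∈ S := hS.subset (by simp)
  have hne : c ≠ c' ∧ d ≠ c' ∧ d ≠ d' := by
    refine ⟨?_, ?_, ?_⟩ <;> (rintro rfl; simp at hdis)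
  have hl := E.outVert_lastIndex a
  have hz := E.outVert_zero a
  rcases h.exists_indices hB ha hm hfst hsnd with ⟨rfl, rfl⟩ |
    ⟨z, i, j, z', hzi, hij, hjz, hzm, rfl, rfl, hsep, hfree, hzS, hzS', hmax⟩
  · rcases h'.exists_indices hB ha hm hfst hsnd with ⟨rfl, _⟩ |
      ⟨w, k, l, w', hwk, hkl, hlw, hwm, rfl, rfl, _⟩
    · exact hne.1 rfl
    · rw [← hl, ← hz] at hord hne
      have := hord.indices hB ha le_rfl (by omega) (by omega) (by omega)
        (by rintro h; exact hne.1 (by rw [← h])) (by rintro h; exact hne.2.1 (by rw [← h]))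
        (by rintro h; exact hne.2.2 (by rw [← h]))
      omega
  · rcases h'.exists_indices hB ha hm hfst hsnd with ⟨rfl, rfl⟩ |
      ⟨w, k, l, w', hwk, hkl, hlw, hwm, rfl, rfl, hsep', hfree', hwS, hwS', hmax'⟩
    · rw [← hl, ← hz] at hord hne
      have := hord.indices hB ha (by omega) le_rfl (by omega) (Nat.zero_le _)
        (by rintro h; exact hne.1 (by rw [h])) (by rintro h; exact hne.2.1 (by rw [h]))
        (by rintro h; exact hne.2.2 (by rw [h]))
      omega
    · have hidx := hord.indices hB ha (by omega) (by omega) (by omega) (by omega)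
        (by rintro rfl; exact hne.1 rfl) (by rintro rfl; exact hne.2.1 rfl)
        (by rintro rfl; exact hne.2.2 rfl)
      -- The order is now `i < k < j < l`. The end `z'` of the first part is a boundary point beyond
      -- `k`, so it cannot come before `l`; hence the separator `{i, l}` obtained by uncrossing
      -- competes in the first part.
      have h1 : l ≤ z' := by
        by_contra hlt
        exact hfree' z' (by omega) (by omega) hzS'
      have h2 := hS.isTwoSeparator_of_crossing hB ha hu huv hends₁ hends₂
        (p := i) (p' := k) (q := j) (q' := l) (by omega) (by omega) (by omega) (by omega)
        hsep hsep' fun t ht ht' => hfree t (by omega) (by omega)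
      have := hmax i l hzi le_rfl (by omega) h1 h2
      omega

/-- Both vertices of a maximal 2-separator are on the Tutte path. -/
theorem IsMaximalSeparator.mem_support [Finite V] (hB : IsBlock B) (ha : E.IsOuterDart a)
    (hm : 2 ≤ E.lastIndex a) (hS : E.IsBoundaryPoints u a v S) (hu : E.OnOuter u) (huv : u ≠ v)
    (hends₁ : ¬ (u = a.fst ∧ v = a.snd)) (hends₂ : ¬ (u = a.snd ∧ v = a.fst))
    (hP : E.IsTuttePath P) (haP : a.edge ∈ P.edges) (hPa : P.edges ≠ [a.edge])
    {c d : V} (h : E.IsMaximalSeparator S c d) : c ∈ P.support ∧ d ∈ P.support := by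
  rcases h.exists_indices hB ha hm (hS.subset (by simp)) (hS.subset (by simp)) with ⟨rfl, rfl⟩ |
    ⟨z, p, q, z', hzp, hpq, hqz, hzm, rfl, rfl, hsep, hfree, hzS, hzS', hmax⟩
  · exact ⟨P.fst_mem_support_of_mem_edges (haP : s(a.fst, a.snd) ∈ P.edges),
      P.snd_mem_support_of_mem_edges (haP : s(a.fst, a.snd) ∈ P.edges)⟩
  have key : ∀ t, t ≤ E.lastIndex a → E.outVert a t ∉ P.support → ∃ i j, i < t ∧ t < j ∧
      j ≤ E.lastIndex a ∧ IsTwoSeparator B (E.outVert a i) (E.outVert a j) ∧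
      ∀ s, i < s → s < j → E.outVert a s ∉ S := by
    intro t ht htP
    have hx : E.outVert a t ∉ P.toSubgraph.verts := fun h => htP (P.mem_verts_toSubgraph.1 h)
    obtain ⟨i, j, h1, h2, h3, _, h4⟩ := hP.exists_interval hB ha hS haP hPa hx ht
      (mem_offComponent_self hx)
    exact ⟨i, j, h1, h2, h3, h4⟩
  constructor
  · by_contra hcon
    obtain ⟨i, j, hip, hpj, hj, hsep', hfree'⟩ := key p (by omega) hcon
    -- The ends of the part are boundary points, so the interval around `p` stays within the part
    -- and is subject to maximality.
    have hzi : z ≤ i := by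
      by_contra h; exact hfree' z (by omega) (by omega) hzS
    have hjz : j ≤ z' := by
      by_contra h; exact hfree' z' (by omega) (by omega) hzS'
    rcases le_or_gt q j with hqj | hjq
    · have := hmax i j hzi hip.le hqj hjz hsep'
      omega
    · have h2 := hS.isTwoSeparator_of_crossing hB ha hu huv hends₁ hends₂ hip hpj hjq
        (by omega) hsep' hsep fun t ht ht' => hfree t (by omega) (by omega)
      have := hmax i q hzi hip.le le_rfl hqz h2
      omega
  · by_contra hcon
    obtain ⟨i, j, hiq, hqj, hj, hsep', hfree'⟩ := key q (by omega) hcon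
    have hzi : z ≤ i := by
      by_contra h; exact hfree' z (by omega) (by omega) hzS
    have hjz : j ≤ z' := by
      by_contra h; exact hfree' z' (by omega) (by omega) hzS'
    rcases le_or_gt i p with hip | hpi
    · have := hmax i j hzi hip hqj.le hjz hsep'
      omega
    · have h2 := hS.isTwoSeparator_of_crossing hB ha hu huv hends₁ hends₂ hpi hiq hqj
        hj hsep hsep' fun t ht ht' => hfree t (by omega) (by omega)
      have := hmax p j hzp le_rfl hqj.le hjz h2
      omega

/-- Every non-trivial outer bridge of the Tutte path is inside a maximal 2-separator. -/
theorem IsTuttePath.exists_isMaximalSeparator [Finite V] (hB : IsBlock B)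
    (ha : E.IsOuterDart a) (hm : 2 ≤ E.lastIndex a) (hS : E.IsBoundaryPoints u a v S)
    (hP : E.IsTuttePath P) (haP : a.edge ∈ P.edges) (hPa : P.edges ≠ [a.edge])
    {J : B.Subgraph} (hJ : IsBridgeOf P.toSubgraph J) (hJo : E.IsOuterSubgraph J)
    (hJn : ¬ IsTrivialBridge J) :
    ∃ (c d : V) (J' : B.Subgraph), E.IsMaximalSeparator S c d ∧ E.IsPlusBridge c d J' ∧
      J ≤ J' := by
  obtain ⟨x, hx, rfl⟩ := hJ.exists_eq_closedStar hJn
  obtain ⟨t, ht, htK⟩ : ∃ t ≤ E.lastIndex a,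
      E.outVert a t ∈ offComponent B P.toSubgraph.verts x := by
    obtain ⟨d, hd, _, h | h⟩ := hJo
    · obtain ⟨t, ht, h'⟩ := (E.onOuter_iff ha).1 ⟨d, hd, rfl⟩
      exact ⟨t, ht, h' ▸ h⟩
    · obtain ⟨t, ht, h'⟩ := (E.onOuter_iff ha).1
        ⟨E.faceNext d, hd.trans ⟨1, by simp⟩, E.faceNext_fst d⟩
      exact ⟨t, ht, h' ▸ h⟩
  obtain ⟨i, j, hit, htj, hj, hint, hsep, hfree⟩ :=
    hP.exists_interval hB ha hS haP hPa hx ht htK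
  obtain ⟨p, q, hpi, hjq, hq, hmax⟩ := E.exists_isMaximalSeparator hB ha hm
    (hS.subset (by simp)) (hS.subset (by simp)) (by omega) hj hfree hsep
  refine ⟨_, _, _, hmax, E.isPlusBridge_closedStar_inside hB ha (by omega) hq,
    closedStar_mono fun y hy => ?_⟩
  -- The component meets `C` only strictly between `i` and `j`, so walks in it from `t` avoid `p`
  -- and `q`.
  obtain ⟨w, hw⟩ := mem_offComponent_trans (mem_offComponent_symm htK) hy
  refine ⟨t, by omega, by omega, w, fun s hs h => ?_⟩
  have hsK := mem_offComponent_trans htK (support_subset_offComponent w hw s hs)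
  rcases h with rfl | rfl
  · have := (hint p (by omega)).1 hsK; omega
  · have := (hint q hq).1 hsK; omega

end PlaneEmbedding
end TuttePaths

theorem mainTheorem5 {V : Type*} [Finite V] (B : SimpleGraph V)
    (hB : TuttePaths.IsBlock B) (E : TuttePaths.PlaneEmbedding B)
    (u v : V) (hu : E.OnOuter u) (huv : u ≠ v)
    (a : B.Dart) (ha : E.IsOuterDart a)
    (S : Set V) (hS : E.IsBoundaryPoints u a v S)
    (P : B.Walk u v) (hP : E.IsTuttePath P) (haP : a.edge ∈ P.edges)
    (hPa : P.edges ≠ [a.edge]) :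
    (∀ c d : V, E.IsMaximalSeparator S c d → c ∈ P.support ∧ d ∈ P.support) ∧
    (∀ c d c' d' : V, E.IsMaximalSeparator S c d → E.IsMaximalSeparator S c' d' →
      ¬ E.Interlace c d c' d') ∧
    (∀ J : B.Subgraph, TuttePaths.IsBridgeOf P.toSubgraph J → E.IsOuterSubgraph J →
      ¬ TuttePaths.IsTrivialBridge J →
      ∃ (c d : V) (J' : B.Subgraph), E.IsMaximalSeparator S c d ∧
        E.IsPlusBridge c d J' ∧ J ≤ J') := by
  have hm : 2 ≤ E.lastIndex a := by
    obtain ⟨w, _, hw⟩ := TuttePaths.exists_third_vertex hP.1 haP hPa a.fst a.snd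
    exact E.two_le_lastIndex hB ⟨w, hw⟩
  -- A path between the ends of `α` that uses `α` is just `α`. Excluding this is what the
  -- exceptional case of the uncrossing lemma needs.
  have hends₁ : ¬ (u = a.fst ∧ v = a.snd) := by
    rintro ⟨rfl, rfl⟩
    exact hPa (TuttePaths.edges_eq_of_mem hP.1 haP)
  have hends₂ : ¬ (u = a.snd ∧ v = a.fst) := by
    rintro ⟨rfl, rfl⟩
    have h : a.edge = s(a.snd, a.fst) := Sym2.eq_swap
    rw [h] at haP hPa
    exact hPa (TuttePaths.edges_eq_of_mem hP.1 haP)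
  refine ⟨fun c d h => h.mem_support hB ha hm hS hu huv hends₁ hends₂ hP haP hPa,
    fun c d c' d' h h' => ?_, fun J hJ hJo hJn =>
    hP.exists_isMaximalSeparator hB ha hm hS haP hPa hJ hJo hJn⟩
  rintro ⟨hdis, hord | hord⟩
  · exact TuttePaths.PlaneEmbedding.not_inClockwiseOrder hB ha hm hS hu huv hends₁ hends₂ h h' hdis hord
  · exact TuttePaths.PlaneEmbedding.not_inClockwiseOrder hB ha hm hS hu huv hends₁ hends₂ h' h hdis.symm hord
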